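/- Let $R$ be one of $\mathbb Z,\mathbb Q,\mathbb R$ with the usual absolute value (or, more generally, any normed commutative ring). Let $G$ be a (discrete) group, let $\mathcal F$ be a family of subgroups of $G$, i.e. a non-empty set of subgroups closed under conjugation and under taking subgroups, and let $V$ be a normed $G$-module, i.e. an $R$-module with an $R$-linear $G$-action and a $G$-invariant norm satisfying $\|rv\|\le |r|\,\|v\|$ for $r\in R$, $v\in V$. For a $G$-set $S$ equip the free module $R[S]$ with the $\ell^1$-norm with respect to the basis $S$, and let $\mathrm{bHom}_R(R[S],V)$ be the module of $R$-linear maps $R[S]\to V$ of finite operator norm, with the $G$-action $(g\cdot f)(c)=g\cdot f(g^{-1}c)$. * With $G/\mathcal F=\coprod_{H\in\mathcal F}G/H$, the bounded Bredon cohomology $H^n_{\mathcal F,b}(G;V)$ is the $n$-th cohomology of the cochain complex of $G$-invariants $\mathrm{bHom}_R(R[(G/\mathcal F)^{*+1}],V)^G$, where $G$ acts diagonally on tuples and the differential is $\delta f(x_0,\dots,x_{n+1})=\sum_{i=0}^{n+1}(-1)^if(x_0,\dots,\widehat{x_i},\dots,x_{n+1})$. * For a $G$-space $X$, with $S_n(X)$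 the $G$-set of singular $n$-simplices of $X$, the equivariant bounded cohomology $H^n_{G,b}(X;V)$ is the $n$-th cohomology of the cochain complex of $G$-invariants $\mathrm{bHom}_R(R[S_*(X)],V)^G$ with the usual singular differential. * A classifying space $E_{\mathcal F}G$ for $\mathcal F$ is a terminal object in the $G$-homotopy category of $G$-CW-complexes with stabilizers in $\mathcal F$: it is a $G$-CW-complex with all stabilizers in $\mathcal F$ such that every $G$-CW-complex $Y$ with all stabilizers in $\mathcal F$ admits a $G$-map $Y\to E_{\mathcal F}G$, and any two such $G$-maps are $G$-homotopic. **Theorem.** For every classifying space $E_{\mathcal F}G$ for $\mathcal F$ and every $n\ge 0$ there is an isomorphism of $R$-modules $$H^n_{\mathcal F,b}(G;V)\;\cong\;H^n_{G,b}(E_{\mathcal F}G;V).$$ -/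

import Mathlib

universe u v w x y

/-! ### Families of subgroups -/

/-- A family of subgroups of `G`: a non-empty set of subgroups that is closed under conjugation
and under taking subgroups. -/
structure SubgroupFamily (G : Type u) [Group G] where
  carrier : Set (Subgroup G)
  nonempty : carrier.Nonempty
  conj_mem : ∀ H ∈ carrier, ∀ g : G, H.map (MulAut.conj g).toMonoidHom ∈ carrier
  mem_of_le : ∀ H ∈ carrier, ∀ K : Subgroup G, K ≤ H → K ∈ carrier

/-- The `G`-set `G/𝓕`, the disjoint union of the `G/H` for `H ∈ 𝓕`. -/
abbrev SubgroupFamily.Cosets {G : Type u} [Group G] (F : SubgroupFamily G) : Type u :=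
  Σ H : F.carrier, G ⧸ H.1

/-! ### Semi-simplicial `G`-sets and their bounded equivariant cohomology -/

/-- A semi-simplicial `G`-set: `G`-sets `obj n` of `n`-simplices with `G`-equivariant face maps
satisfying the semi-simplicial identities. -/
structure SemisimplicialGSet (G : Type u) [Group G] where
  obj : ℕ → Type w
  action : ∀ n, MulAction G (obj n)
  face : ∀ n, Fin (n + 2) → obj (n + 1) → obj n
  face_smul : ∀ n (i : Fin (n + 2)) (g : G) (s : obj (n + 1)), face n i (g • s) = g • face n i s
  face_face : ∀ n (i j : Fin (n + 2)), i ≤ j → ∀ s : obj (n + 2),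
    face n i (face (n + 1) j.succ s) = face n j (face (n + 1) i.castSucc s)

attribute [instance] SemisimplicialGSet.action

/-- The `ℓ¹`-norm on the free module `R[S]` with respect to the basis `S`. -/
noncomputable def l1Norm {S : Type w} {R : Type x} [NormedCommRing R] (c : S →₀ R) : ℝ :=
  c.sum fun _ r => ‖r‖

theorem l1Norm_add_le {S : Type w} {R : Type x} [NormedCommRing R] (c d : S →₀ R) :
    l1Norm (c + d) ≤ l1Norm c + l1Norm d := by
  classical
  have h0 : ∀ s : S, ‖(0 : R)‖ = 0 := fun _ => norm_zero
  unfold l1Norm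
  rw [Finsupp.sum_of_support_subset _ Finsupp.support_add _ (fun s _ => h0 s),
    Finsupp.sum_of_support_subset c (Finset.subset_union_left (s₂ := d.support)) _
      (fun s _ => h0 s),
    Finsupp.sum_of_support_subset d (Finset.subset_union_right (s₁ := c.support)) _
      (fun s _ => h0 s), ← Finset.sum_add_distrib]
  exact Finset.sum_le_sum fun s _ => norm_add_le _ _

theorem l1Norm_mapDomain_le {S : Type w} {T : Type y} {R : Type x} [NormedCommRing R]
    (φ : S → T) (c : S →₀ R) : l1Norm (c.mapDomain φ) ≤ l1Norm c := by
  classical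
  induction c using Finsupp.induction with
  | zero => simp [l1Norm]
  | single_add a b f ha hb ih =>
    have h1 : l1Norm (Finsupp.single a b + f) = ‖b‖ + l1Norm f := by
      unfold l1Norm
      rw [Finsupp.sum_add_index_of_disjoint]
      · simp
      · simpa [Finsupp.support_single, hb] using ha
    rw [h1, Finsupp.mapDomain_add, Finsupp.mapDomain_single]
    refine (l1Norm_add_le _ _).trans (add_le_add ?_ ih)
    simp [l1Norm]

namespace SemisimplicialGSet

variable {G : Type u} [Group G] (S : SemisimplicialGSet.{u, w} G)
variable (R : Type x) [NormedCommRing R]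
variable (V : Type y) [NormedAddCommGroup V] [Module R V] [IsBoundedSMul R V]
  [DistribMulAction G V] [SMulCommClass G R V]

/-- The boundary map `R[S_{n+1}] → R[S_n]`, the alternating sum of the face maps. -/
noncomputable def boundary (n : ℕ) : (S.obj (n + 1) →₀ R) →ₗ[R] (S.obj n →₀ R) :=
  ∑ i : Fin (n + 2), (-1 : R) ^ (i : ℕ) • Finsupp.lmapDomain R R (S.face n i)

theorem boundary_boundary (n : ℕ) (c : S.obj (n + 2) →₀ R) :
    S.boundary R n (S.boundary R (n + 1) c) = 0 := by
  suffices h : S.boundary R n ∘ₗ S.boundary R (n + 1) = 0 by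
    exact (LinearMap.congr_fun h c :)
  ext1 s
  ext1
  let t : Fin (n + 2) × Fin (n + 3) → (S.obj n →₀ R) := fun q =>
    (-1 : R) ^ ((q.1 : ℕ) + (q.2 : ℕ)) • Finsupp.single (S.face n q.1 (S.face (n + 1) q.2 s)) 1
  have hlhs : (S.boundary R n ∘ₗ S.boundary R (n + 1)) (Finsupp.single s 1) = ∑ q, t q := by
    rw [Fintype.sum_prod_type_right]
    simp only [boundary, LinearMap.comp_apply, LinearMap.sum_apply, LinearMap.smul_apply,
      Finsupp.lmapDomain_apply, Finsupp.mapDomain_single, map_sum, map_smul, Finset.smul_sum,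
      smul_smul, t]
    refine Fintype.sum_congr _ _ fun i => Fintype.sum_congr _ _ fun j => ?_
    rw [pow_add, mul_comm]
  have key : ∀ (i j : Fin (n + 2)), i ≤ j → t (i, j.succ) + t (j, i.castSucc) = 0 := by
    intro i j h
    simp only [t, S.face_face n i j h s, ← add_smul]
    have : (-1 : R) ^ ((i : ℕ) + (j.succ : ℕ)) + (-1) ^ ((j : ℕ) + (i.castSucc : ℕ)) = 0 := by
      simp only [Fin.val_succ, Fin.val_castSucc]
      ring
    rw [this, zero_smul]
  let φ : Fin (n + 2) × Fin (n + 3) → Fin (n + 2) × Fin (n + 3) := fun q =>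
    if h : (q.1 : ℕ) < q.2 then (⟨q.2 - 1, by omega⟩, q.1.castSucc)
    else (⟨q.2, by omega⟩, q.1.succ)
  have hsum : ∑ q, t q = 0 := by
    refine Finset.sum_involution (fun q _ => φ q) ?_ ?_ (fun _ _ => Finset.mem_univ _) ?_
    · rintro ⟨i, j⟩ -
      by_cases h : (i : ℕ) < j
      · have := key i ⟨j - 1, by omega⟩ (by rw [Fin.le_def]; dsimp only; omega)
        have hj : (⟨j - 1, by omega⟩ : Fin (n + 2)).succ = j := by
          ext; simp only [Fin.val_succ]; omega
        rw [hj] at this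
        simpa only [φ, h, dif_pos] using this
      · have := key ⟨j, by omega⟩ i (by rw [Fin.le_def]; dsimp only; omega)
        rw [add_comm] at this
        have hj : (⟨j, by omega⟩ : Fin (n + 2)).castSucc = j := rfl
        rw [hj] at this
        simpa only [φ, h, dif_neg, not_false_eq_true] using this
    · rintro ⟨i, j⟩ - - heq
      have h2 := congrArg (fun q => (q.2 : ℕ)) heq
      by_cases h : (i : ℕ) < j
      · simp [φ, h] at h2
        omega
      · simp [φ, h] at h2
        omega
    · rintro ⟨i, j⟩ -
      by_cases h : (i : ℕ) < j
      · have h' : ¬ (j : ℕ) - 1 < i := by omega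
        simp [φ, h, h', Prod.ext_iff, Fin.ext_iff]
        omega
      · have h' : (j : ℕ) < i + 1 := by omega
        simp [φ, h, h']
  simp only [LinearMap.zero_comp, LinearMap.zero_apply]
  rw [LinearMap.comp_apply, Finsupp.lsingle_apply, hlhs, hsum]

/-- The `n`-cochains: the `G`-invariants of the module of bounded `R`-linear maps `R[S_n] → V`,
that is, the `R`-linear maps with finite operator norm (for the `ℓ¹`-norm on `R[S_n]`) that are
`G`-equivariant. -/
def boundedCochains (n : ℕ) : Submodule R ((S.obj n →₀ R) →ₗ[R] V) where
  carrier := {f | (∃ C : ℝ, ∀ c, ‖f c‖ ≤ C * l1Norm c) ∧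
    ∀ (g : G) (c : S.obj n →₀ R), f (c.mapDomain (g • ·)) = g • f c}
  zero_mem' := ⟨⟨0, fun c => by simp⟩, fun g c => by simp⟩
  add_mem' := by
    rintro f₁ f₂ ⟨⟨C₁, h₁⟩, e₁⟩ ⟨⟨C₂, h₂⟩, e₂⟩
    refine ⟨⟨C₁ + C₂, fun c => ?_⟩, fun g c => ?_⟩
    · rw [LinearMap.add_apply, add_mul]
      exact (norm_add_le _ _).trans (add_le_add (h₁ c) (h₂ c))
    · rw [LinearMap.add_apply, LinearMap.add_apply, e₁, e₂, smul_add]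
  smul_mem' := by
    rintro r f ⟨⟨C, h⟩, e⟩
    refine ⟨⟨‖r‖ * C, fun c => ?_⟩, fun g c => ?_⟩
    · rw [LinearMap.smul_apply, mul_assoc]
      exact (norm_smul_le _ _).trans (mul_le_mul_of_nonneg_left (h c) (norm_nonneg r))
    · rw [LinearMap.smul_apply, LinearMap.smul_apply, e, smul_comm g r]

theorem comp_boundary_mem (n : ℕ) (f : (S.obj n →₀ R) →ₗ[R] V)
    (hf : f ∈ S.boundedCochains R V n) :
    f ∘ₗ S.boundary R n ∈ S.boundedCochains R V (n + 1) := by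
  have hsum : f ∘ₗ S.boundary R n = ∑ i : Fin (n + 2),
      (-1 : R) ^ (i : ℕ) • (f ∘ₗ Finsupp.lmapDomain R R (S.face n i)) := by
    refine LinearMap.ext fun c => ?_
    simp only [boundary, LinearMap.comp_apply, LinearMap.sum_apply, LinearMap.smul_apply, map_sum,
      map_smul]
  rw [hsum]
  refine Submodule.sum_mem _ fun i _ => Submodule.smul_mem _ _ ?_
  obtain ⟨⟨C, hC⟩, he⟩ := hf
  have hC' : ∀ c, ‖f c‖ ≤ |C| * l1Norm c := fun c =>
    (hC c).trans (mul_le_mul_of_nonneg_right (le_abs_self C)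
      (Finset.sum_nonneg fun _ _ => norm_nonneg _))
  refine ⟨⟨|C|, fun c => ?_⟩, fun g c => ?_⟩
  · exact (hC' _).trans (mul_le_mul_of_nonneg_left (l1Norm_mapDomain_le _ _) (abs_nonneg C))
  · have hcomm : (S.face n i) ∘ (fun s => g • s) = (fun s => g • s) ∘ (S.face n i) :=
      funext fun s => S.face_smul n i g s
    simp only [LinearMap.comp_apply, Finsupp.lmapDomain_apply]
    rw [← he, ← Finsupp.mapDomain_comp, ← Finsupp.mapDomain_comp, hcomm]

/-- The `R`-module of bounded `G`-equivariant `n`-cochains, as a type. -/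
def BoundedCochain (n : ℕ) : Type (max w x y) := S.boundedCochains R V n

noncomputable instance (n : ℕ) : AddCommGroup (S.BoundedCochain R V n) :=
  inferInstanceAs (AddCommGroup (S.boundedCochains R V n))

noncomputable instance (n : ℕ) : Module R (S.BoundedCochain R V n) :=
  inferInstanceAs (Module R (S.boundedCochains R V n))

/-- The coboundary map `f ↦ f ∘ ∂` on bounded equivariant cochains. -/
noncomputable def coboundary (n : ℕ) : S.BoundedCochain R V n →ₗ[R] S.BoundedCochain R V (n + 1) where
  toFun f := ⟨f.1 ∘ₗ S.boundary R n, S.comp_boundary_mem R V n f.1 f.2⟩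
  map_add' _ _ := rfl
  map_smul' _ _ := rfl

theorem coboundary_coboundary (n : ℕ) (f : S.BoundedCochain R V n) :
    S.coboundary R V (n + 1) (S.coboundary R V n f) = 0 := by
  apply Subtype.ext
  refine LinearMap.ext fun c => ?_
  change f.1 (S.boundary R n (S.boundary R (n + 1) c)) = 0
  rw [boundary_boundary, map_zero]

/-- The image of the coboundary map ending in degree `n` (zero in degree `0`). -/
noncomputable def coboundaries : ∀ n, Submodule R (S.BoundedCochain R V n)
  | 0 => ⊥
  | n + 1 => LinearMap.range (S.coboundary R V n)

/-- The `n`-th cohomology module of the complex of bounded equivariant cochains. -/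
abbrev BoundedCohomology (n : ℕ) : Type (max w x y) :=
  LinearMap.ker (S.coboundary R V n) ⧸
    (S.coboundaries R V n).submoduleOf (LinearMap.ker (S.coboundary R V n))

end SemisimplicialGSet

/-! ### The two instances: `(G/𝓕)^{n+1}` and singular simplices -/

theorem succAbove_face_face {n : ℕ} {i j : Fin (n + 2)} (h : i ≤ j) (k : Fin (n + 1)) :
    j.succ.succAbove (i.succAbove k) = i.castSucc.succAbove (j.succAbove k) := by
  rcases i with ⟨i, _⟩
  rcases j with ⟨j, _⟩
  rcases k with ⟨k, _⟩
  dsimp [Fin.succAbove]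
  split_ifs <;> · simp at * <;> lia

/-- The semi-simplicial `G`-set with `n`-simplices `(G/𝓕)^{n+1}`, the diagonal `G`-action, and
faces omitting one entry. -/
def SubgroupFamily.cosetTuples {G : Type u} [Group G] (F : SubgroupFamily G) :
    SemisimplicialGSet.{u, u} G where
  obj n := Fin (n + 1) → F.Cosets
  action _ := inferInstance
  face _ i s := fun k => s (i.succAbove k)
  face_smul _ _ _ _ := rfl
  face_face n i j h s := by
    funext k
    simp only [succAbove_face_face h]

/-- The bounded Bredon cohomology `H^n_{𝓕,b}(G;V)`. -/
abbrev BoundedBredonCohomology {G : Type u} [Group G] (F : SubgroupFamily G)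
    (R : Type x) [NormedCommRing R]
    (V : Type y) [NormedAddCommGroup V] [Module R V] [IsBoundedSMul R V]
    [DistribMulAction G V] [SMulCommClass G R V] (n : ℕ) : Type (max u x y) :=
  F.cosetTuples.BoundedCohomology R V n

/-- The affine inclusion `Δ^n → Δ^{n+1}` onto the face opposite to the `i`-th vertex. -/
noncomputable def simplexFaceInclusion (n : ℕ) (i : Fin (n + 2)) :
    C(stdSimplex ℝ (Fin (n + 1)), stdSimplex ℝ (Fin (n + 2))) where
  toFun := stdSimplex.map i.succAbove
  continuous_toFun := stdSimplex.continuous_map _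

section GSpaces

variable (G : Type u) [Group G]

/-- The semi-simplicial `G`-set of singular simplices of a `G`-space `X`. -/
noncomputable def singularSimplices (X : Type v) [TopologicalSpace X] [MulAction G X]
    [ContinuousConstSMul G X] : SemisimplicialGSet.{u, v} G where
  obj n := C(stdSimplex ℝ (Fin (n + 1)), X)
  action _ := inferInstance
  face n i s := s.comp (simplexFaceInclusion n i)
  face_smul _ _ _ _ := rfl
  face_face n i j h s := by
    ext p
    simp only [ContinuousMap.comp_apply]
    congr 1
    change stdSimplex.map _ (stdSimplex.map _ p) = stdSimplex.map _ (stdSimplex.map _ p)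
    rw [stdSimplex.map_comp_apply, stdSimplex.map_comp_apply]
    congr 1
    funext k
    exact succAbove_face_face h k

/-- The `G`-equivariant bounded cohomology `H^n_{G,b}(X;V)` of a `G`-space `X`. -/
abbrev EquivariantBoundedCohomology (X : Type v) [TopologicalSpace X] [MulAction G X]
    [ContinuousConstSMul G X] (R : Type x) [NormedCommRing R]
    (V : Type y) [NormedAddCommGroup V] [Module R V] [IsBoundedSMul R V]
    [DistribMulAction G V] [SMulCommClass G R V] (n : ℕ) : Type (max v x y) :=
  (singularSimplices G X).BoundedCohomology R V n

/-! ### `G`-CW-complexes and classifying spaces for families -/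

/-- A `G`-CW-structure (for a discrete group `G`) on a space `X` with a `G`-action.
The set `skel n` is the `(n-1)`-skeleton `X_{n-1}`, so that `skel 0` is empty, and `X` is the
union of the skeleta with the colimit topology. The space `X_n` arises from `X_{n-1}` as a
`G`-pushout, by attaching equivariant cells `G/H_i × D^n` along `G/H_i × S^{n-1}`: the
characteristic maps send `G/H_i × S^{n-1}` to `X_{n-1}`, they map the disjoint union of the
`G/H_i × int D^n` bijectively to `X_n ∖ X_{n-1}`, and `X_n` carries the quotient topology. -/
structure GCWStructure (X : Type v) [TopologicalSpace X] [MulAction G X] where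
  skel : ℕ → Set X
  skel_zero : skel 0 = ∅
  skel_subset_succ : ∀ n, skel n ⊆ skel (n + 1)
  smul_mem_skel : ∀ n (g : G), ∀ p ∈ skel n, g • p ∈ skel n
  iUnion_skel : ⋃ n, skel n = Set.univ
  isClosed_of_skel : ∀ A : Set X, (∀ n, IsClosed (A ∩ skel n)) → IsClosed A
  /-- the index set of the equivariant `n`-cells -/
  cell : ℕ → Type v
  /-- the subgroup `H_i` of an equivariant cell `G/H_i × D^n` -/
  isotropy : ∀ n, cell n → Subgroup G
  charMap : ∀ n (i : cell n), G ⧸ isotropy n i →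
    Metric.closedBall (0 : EuclideanSpace ℝ (Fin n)) 1 → X
  continuous_charMap : ∀ n (i : cell n) (a : G ⧸ isotropy n i), Continuous (charMap n i a)
  charMap_smul : ∀ n (i : cell n) (g : G) (a : G ⧸ isotropy n i)
    (p : Metric.closedBall (0 : EuclideanSpace ℝ (Fin n)) 1),
    charMap n i (g • a) p = g • charMap n i a p
  charMap_boundary : ∀ n (i : cell n) (a : G ⧸ isotropy n i)
    (p : Metric.closedBall (0 : EuclideanSpace ℝ (Fin n)) 1),
    ‖(p : EuclideanSpace ℝ (Fin n))‖ = 1 → charMap n i a p ∈ skel n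
  charMap_interior : ∀ n, Set.BijOn
    (fun q : (Σ i : cell n, G ⧸ isotropy n i) ×
        Metric.closedBall (0 : EuclideanSpace ℝ (Fin n)) 1 => charMap n q.1.1 q.1.2 q.2)
    {q | ‖(q.2 : EuclideanSpace ℝ (Fin n))‖ < 1} (skel (n + 1) \ skel n)
  isClosed_of_charMap : ∀ n, ∀ B ⊆ skel (n + 1), IsClosed (B ∩ skel n) →
    (∀ (i : cell n) (a : G ⧸ isotropy n i), IsClosed (charMap n i a ⁻¹' B)) → IsClosed B

variable {G}

/-- `X` is a `G`-CW-complex whose stabilizers all belong to the family `𝓕`. -/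
structure IsGCWComplexWithStabilizersIn (F : SubgroupFamily G) (X : Type v)
    [TopologicalSpace X] [MulAction G X] [ContinuousConstSMul G X] : Prop where
  nonempty_structure : Nonempty (GCWStructure G X)
  stabilizer_mem : ∀ p : X, MulAction.stabilizer G p ∈ F.carrier

/-- A continuous map between `G`-spaces is a `G`-map if it is equivariant. -/
def IsGMap {Y : Type w} {X : Type v} [TopologicalSpace Y] [TopologicalSpace X]
    [MulAction G Y] [MulAction G X] (f : C(Y, X)) : Prop :=
  ∀ (g : G) (p : Y), f (g • p) = g • f p

/-- `X` is a classifying space for the family `𝓕`, a model for `E_𝓕 G`: a terminal object in the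
`G`-homotopy category of `G`-CW-complexes with stabilizers in `𝓕`. That is, every such `Y`
admits a `G`-map to `X`, and any two `G`-maps from `Y` to `X` are homotopic through `G`-maps.
(The universe of `Y` is large enough to contain copies of `X` and of all `G`-sets `G/H`.) -/
structure IsClassifyingSpace (F : SubgroupFamily G) (X : Type v)
    [TopologicalSpace X] [MulAction G X] [ContinuousConstSMul G X] : Prop where
  isGCWComplex : IsGCWComplexWithStabilizersIn F X
  exists_gMap : ∀ (Y : Type (max u v)) [TopologicalSpace Y] [MulAction G Y]
    [ContinuousConstSMul G Y], IsGCWComplexWithStabilizersIn F Y →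
    ∃ f : C(Y, X), IsGMap (G := G) f
  gHomotopic : ∀ (Y : Type (max u v)) [TopologicalSpace Y] [MulAction G Y]
    [ContinuousConstSMul G Y], IsGCWComplexWithStabilizersIn F Y →
    ∀ f₀ f₁ : C(Y, X), IsGMap (G := G) f₀ → IsGMap (G := G) f₁ →
      ContinuousMap.HomotopicWith f₀ f₁ (IsGMap (G := G))

end GSpaces

/-! The proof is a bounded, equivariant form of the method of acyclic carriers. Let `S` be a
semi-simplicial `G`-set with stabilizers in `𝓕` such that, for each `H ∈ 𝓕`, the `H`-fixed simplices
can be coned off to an apex (`FixedCone`). Coning contracts the augmented chain complex of the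
`H`-fixed simplices, and it does not increase the ℓ¹-norm because it sends simplices to simplices.
Between two such objects a chain map over the augmentation is built degree by degree: on an orbit
representative `s` a value is chosen by coning among the chains fixed by the stabilizer of `s`, and
it is spread equivariantly over the orbit. The resulting maps are bounded in each degree and unique
up to bounded equivariant homotopy, so the bounded cohomologies agree
(`nonempty_boundedCohomology_equiv`).

It remains to find cones for both complexes. For coset tuples, the trivial coset of `H` is
prepended. For singular simplices, the fixed space `X^H` of a classifying space is contractible
(`IsClassifyingSpace.exists_contraction`): `G/H × X^H` is a `G`-CW-complex with stabilizers in `𝓕`,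
so its `G`-maps `(gH, z) ↦ gz` and `(gH, z) ↦ gz₀` to `X` are `G`-homotopic, and on the trivial
coset the homotopy is a contraction of `X^H`. Singular simplices in `X^H` are coned along it. -/

/-! ### Estimates for the ℓ¹-norm. -/

theorem l1Norm_nonneg {S : Type w} {R : Type x} [NormedCommRing R] (c : S →₀ R) :
    0 ≤ l1Norm c :=
  Finset.sum_nonneg fun _ _ => norm_nonneg _

theorem l1Norm_smul_le {S : Type w} {R : Type x} [NormedCommRing R] (r : R) (c : S →₀ R) :
    l1Norm (r • c) ≤ ‖r‖ * l1Norm c := by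
  unfold l1Norm
  rw [Finsupp.sum_of_support_subset _ Finsupp.support_smul _ (fun s _ => norm_zero),
    Finsupp.sum, Finset.mul_sum]
  exact Finset.sum_le_sum fun s _ => norm_mul_le _ _

theorem l1Norm_sum_le {S : Type w} {ι : Type y} {R : Type x} [NormedCommRing R] (s : Finset ι)
    (c : ι → S →₀ R) : l1Norm (∑ i ∈ s, c i) ≤ ∑ i ∈ s, l1Norm (c i) := by
  classical
  induction s using Finset.induction_on with
  | empty => simp [l1Norm]
  | insert a s ha ih =>
    rw [Finset.sum_insert ha, Finset.sum_insert ha]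
    exact (l1Norm_add_le _ _).trans (by gcongr)

namespace SemisimplicialGSet

variable {G : Type u} [Group G]

/-! ### Cones on fixed simplices and the contraction of the augmented complex. -/

/-- The set of `n`-simplices fixed by a subgroup `H`. -/
def fixedSimplices (S : SemisimplicialGSet.{u, w} G) (H : Subgroup G) (n : ℕ) : Set (S.obj n) :=
  {s | ∀ h ∈ H, h • s = s}

/-- An extra degeneracy on the `H`-fixed simplices: coning off with apex `base`. -/
structure FixedCone (S : SemisimplicialGSet.{u, w} G) (H : Subgroup G) where
  base : S.obj 0
  -- The cone is defined on all simplices, so that it can be pushed through `mapDomain`, but it is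
  -- constrained only on the fixed ones.
  cone : ∀ n, S.obj n → S.obj (n + 1)
  base_mem : base ∈ S.fixedSimplices H 0
  cone_mem : ∀ n, ∀ s ∈ S.fixedSimplices H n, cone n s ∈ S.fixedSimplices H (n + 1)
  face_zero_cone : ∀ n, ∀ s ∈ S.fixedSimplices H n, S.face n 0 (cone n s) = s
  face_one_cone : ∀ s ∈ S.fixedSimplices H 0, S.face 0 1 (cone 0 s) = base
  face_succ_cone : ∀ n, ∀ s ∈ S.fixedSimplices H (n + 1), ∀ i : Fin (n + 2),
    S.face (n + 1) i.succ (cone (n + 1) s) = cone n (S.face n i s)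

variable (S : SemisimplicialGSet.{u, w} G) (T : SemisimplicialGSet.{u, v} G)
variable (R : Type x) [NormedCommRing R]

/-- The augmentation `R[S_0] → R`. -/
noncomputable def augmentation : (S.obj 0 →₀ R) →ₗ[R] R :=
  Finsupp.linearCombination R fun _ => 1

@[simp]
theorem augmentation_single (s : S.obj 0) (r : R) :
    S.augmentation R (Finsupp.single s r) = r := by
  simp [augmentation]

@[simp]
theorem boundary_single (n : ℕ) (s : S.obj (n + 1)) (r : R) :
    S.boundary R n (Finsupp.single s r) =
      ∑ i : Fin (n + 2), (-1 : R) ^ (i : ℕ) • Finsupp.single (S.face n i s) r := by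
  simp [boundary, LinearMap.sum_apply, Finsupp.mapDomain_single]

theorem augmentation_boundary (c : S.obj 1 →₀ R) :
    S.augmentation R (S.boundary R 0 c) = 0 := by
  suffices h : S.augmentation R ∘ₗ S.boundary R 0 = 0 from LinearMap.congr_fun h c
  ext s
  simp [Fin.sum_univ_two]

theorem boundary_smul (n : ℕ) (g : G) (c : S.obj (n + 1) →₀ R) :
    S.boundary R n (c.mapDomain (g • ·)) = (S.boundary R n c).mapDomain (g • ·) := by
  suffices h : S.boundary R n ∘ₗ Finsupp.lmapDomain R R (g • ·) =
      Finsupp.lmapDomain R R (g • ·) ∘ₗ S.boundary R n from LinearMap.congr_fun h c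
  ext1 s
  ext1
  simp [Finsupp.mapDomain_single, map_sum, S.face_smul, -Finsupp.smul_single]

theorem augmentation_smul (g : G) (c : S.obj 0 →₀ R) :
    S.augmentation R (c.mapDomain (g • ·)) = S.augmentation R c := by
  suffices h : S.augmentation R ∘ₗ Finsupp.lmapDomain R R (g • ·) =
      S.augmentation R from LinearMap.congr_fun h c
  ext s
  simp [Finsupp.mapDomain_single]

/-- The cycles of the augmented chain complex. -/
noncomputable def cycles : ∀ n, Submodule R (S.obj n →₀ R)
  -- With the augmentation kernel in degree zero, cones make cycles bound in every degree.
  | 0 => LinearMap.ker (S.augmentation R)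
  | n + 1 => LinearMap.ker (S.boundary R n)

variable {S T R}

/-- By linearity it suffices to treat one fixed vertex `s`, whose cone is an edge with faces `s` and
the apex. -/
theorem FixedCone.boundary_cone_zero {H : Subgroup G} (K : S.FixedCone H) (c : S.obj 0 →₀ R)
    (hc : c ∈ Finsupp.supported R R (S.fixedSimplices H 0)) :
    S.boundary R 0 (c.mapDomain (K.cone 0)) =
      c - S.augmentation R c • Finsupp.single K.base 1 := by
  rw [Finsupp.supported_eq_span_single] at hc
  induction hc using Submodule.span_induction with
  | mem _ h =>
    obtain ⟨s, hs, rfl⟩ := h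
    simp [Finsupp.mapDomain_single, Fin.sum_univ_two, K.face_zero_cone 0 s hs,
      K.face_one_cone s hs, sub_eq_add_neg]
  | zero => simp
  | add _ _ _ _ h₁ h₂ =>
    rw [Finsupp.mapDomain_add, map_add, h₁, h₂, map_add, add_smul]
    abel
  | smul r _ _ h =>
    rw [Finsupp.mapDomain_smul, map_smul, h, map_smul, smul_sub, smul_assoc]

/-- Face `0` of a cone returns the simplex; face `i + 1` is the cone on face `i`, and the index
shift produces the minus sign. -/
theorem FixedCone.boundary_cone_succ {H : Subgroup G} (K : S.FixedCone H) (n : ℕ)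
    (c : S.obj (n + 1) →₀ R)
    (hc : c ∈ Finsupp.supported R R (S.fixedSimplices H (n + 1))) :
    S.boundary R (n + 1) (c.mapDomain (K.cone (n + 1))) =
      c - (S.boundary R n c).mapDomain (K.cone n) := by
  rw [Finsupp.supported_eq_span_single] at hc
  induction hc using Submodule.span_induction with
  | mem _ h =>
    obtain ⟨s, hs, rfl⟩ := h
    rw [Finsupp.mapDomain_single, boundary_single, Fin.sum_univ_succ, boundary_single,
      Finsupp.mapDomain_finsetSum, sub_eq_add_neg, ← Finset.sum_neg_distrib]
    congr 1
    · simp [K.face_zero_cone _ s hs]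
    · refine Finset.sum_congr rfl fun i _ => ?_
      rw [K.face_succ_cone n s hs, Finsupp.mapDomain_smul, Finsupp.mapDomain_single,
        Fin.val_succ, pow_succ, mul_neg_one, neg_smul]
  | zero => simp
  | add _ _ _ _ h₁ h₂ =>
    rw [Finsupp.mapDomain_add, map_add, h₁, h₂, map_add, Finsupp.mapDomain_add]
    abel
  | smul r _ _ h =>
    rw [Finsupp.mapDomain_smul, map_smul, h, map_smul, smul_sub, Finsupp.mapDomain_smul]

theorem FixedCone.boundary_cone_of_mem_cycles {H : Subgroup G} (K : S.FixedCone H) (n : ℕ)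
    (c : S.obj n →₀ R) (hc : c ∈ Finsupp.supported R R (S.fixedSimplices H n))
    (hz : c ∈ S.cycles R n) :
    S.boundary R n (c.mapDomain (K.cone n)) = c := by
  cases n with
  | zero =>
    have : S.augmentation R c = 0 := hz
    rw [K.boundary_cone_zero c hc, this, zero_smul, sub_zero]
  | succ n =>
    have : S.boundary R n c = 0 := hz
    rw [K.boundary_cone_succ n c hc, this, Finsupp.mapDomain_zero, sub_zero]

/-! ### Chains of fixed simplices and carried maps. -/

theorem mapDomain_mem_supported {A : Type v} {B : Type w} {φ : A → B} {s : Set A} {t : Set B}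
    (h : ∀ a ∈ s, φ a ∈ t) {c : A →₀ R} (hc : c ∈ Finsupp.supported R R s) :
    c.mapDomain φ ∈ Finsupp.supported R R t := by
  classical
  rw [Finsupp.mem_supported] at hc ⊢
  intro b hb
  obtain ⟨a, ha, rfl⟩ := Finset.mem_image.1 (Finsupp.mapDomain_support hb)
  exact h a (hc ha)

theorem mapDomain_smul_eq_self {H : Subgroup G} {n : ℕ} {c : S.obj n →₀ R}
    (hc : c ∈ Finsupp.supported R R (S.fixedSimplices H n)) {h : G} (hh : h ∈ H) :
    c.mapDomain (h • ·) = c := by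
  conv_rhs => rw [← Finsupp.mapDomain_id (v := c)]
  exact Finsupp.mapDomain_congr fun s hs => hc hs h hh

theorem mapDomain_mul_smul {n : ℕ} (g h : G) (c : S.obj n →₀ R) :
    c.mapDomain ((g * h) • ·) = (c.mapDomain (h • ·)).mapDomain (g • ·) := by
  rw [← Finsupp.mapDomain_comp]
  congr 1
  funext s
  exact mul_smul g h s

theorem fixedSimplices_anti {H K : Subgroup G} (h : H ≤ K) (n : ℕ) :
    S.fixedSimplices K n ⊆ S.fixedSimplices H n :=
  fun _ hs g hg => hs g (h hg)

/-- The stabilizer of `g • s` is the conjugate by `g` of the stabilizer of `s`. -/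
theorem smul_mem_fixedSimplices {n m : ℕ} {s : S.obj n} {t : T.obj m} (g : G)
    (ht : t ∈ T.fixedSimplices (MulAction.stabilizer G s) m) :
    g • t ∈ T.fixedSimplices (MulAction.stabilizer G (g • s)) m := by
  intro h hh
  have : (g⁻¹ * h * g) • t = t := by
    refine ht _ ?_
    rw [MulAction.mem_stabilizer_iff] at hh ⊢
    rw [mul_smul, mul_smul, hh, inv_smul_smul]
  rw [mul_smul, mul_smul, inv_smul_eq_iff] at this
  exact this

/-- Bounded equivariant maps of chain modules that send each simplex to a chain of simplices fixed
by its stabilizer. -/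
def carriedMaps (S : SemisimplicialGSet.{u, w} G) (T : SemisimplicialGSet.{u, v} G)
    (R : Type x) [NormedCommRing R] (n m : ℕ) :
    Submodule R ((S.obj n →₀ R) →ₗ[R] (T.obj m →₀ R)) where
  carrier := {Φ | (∃ C : ℝ, 0 ≤ C ∧ ∀ c, l1Norm (Φ c) ≤ C * l1Norm c) ∧
    (∀ (g : G) (c : S.obj n →₀ R), Φ (c.mapDomain (g • ·)) = (Φ c).mapDomain (g • ·)) ∧
    -- Demanding this for every subgroup, and not only for stabilizers, makes closure under
    -- composition immediate.
    ∀ H : Subgroup G, ∀ c ∈ Finsupp.supported R R (S.fixedSimplices H n),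
      Φ c ∈ Finsupp.supported R R (T.fixedSimplices H m)}
  zero_mem' := ⟨⟨0, le_rfl, fun c => by simp [l1Norm]⟩, fun g c => by simp,
    fun H c _ => Submodule.zero_mem _⟩
  add_mem' := by
    rintro f₁ f₂ ⟨⟨C₁, p₁, h₁⟩, e₁, s₁⟩ ⟨⟨C₂, p₂, h₂⟩, e₂, s₂⟩
    refine ⟨⟨C₁ + C₂, add_nonneg p₁ p₂, fun c => ?_⟩, fun g c => ?_, fun H c hc => ?_⟩
    · rw [LinearMap.add_apply, add_mul]
      exact (l1Norm_add_le _ _).trans (add_le_add (h₁ c) (h₂ c))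
    · rw [LinearMap.add_apply, LinearMap.add_apply, e₁, e₂, Finsupp.mapDomain_add]
    · exact Submodule.add_mem _ (s₁ H c hc) (s₂ H c hc)
  smul_mem' := by
    rintro r f ⟨⟨C, p, h⟩, e, s⟩
    refine ⟨⟨‖r‖ * C, mul_nonneg (norm_nonneg r) p, fun c => ?_⟩, fun g c => ?_,
      fun H c hc => Submodule.smul_mem _ r (s H c hc)⟩
    · rw [LinearMap.smul_apply, mul_assoc]
      exact (l1Norm_smul_le _ _).trans (mul_le_mul_of_nonneg_left (h c) (norm_nonneg r))
    · rw [LinearMap.smul_apply, LinearMap.smul_apply, e, Finsupp.mapDomain_smul]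

theorem id_mem_carriedMaps (n : ℕ) : LinearMap.id ∈ carriedMaps S S R n n :=
  ⟨⟨1, zero_le_one, fun c => by simp⟩, fun _ _ => rfl, fun _ _ hc => hc⟩

theorem comp_mem_carriedMaps {U : SemisimplicialGSet.{u, y} G} {n m k : ℕ}
    {Ψ : (T.obj m →₀ R) →ₗ[R] (U.obj k →₀ R)} {Φ : (S.obj n →₀ R) →ₗ[R] (T.obj m →₀ R)}
    (hΨ : Ψ ∈ carriedMaps T U R m k) (hΦ : Φ ∈ carriedMaps S T R n m) :
    Ψ ∘ₗ Φ ∈ carriedMaps S U R n k := by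
  obtain ⟨⟨C, p, h⟩, e, s⟩ := hΨ
  obtain ⟨⟨C', p', h'⟩, e', s'⟩ := hΦ
  refine ⟨⟨C * C', mul_nonneg p p', fun c => ?_⟩, fun g c => ?_,
    fun H c hc => s H _ (s' H c hc)⟩
  · rw [mul_assoc]
    exact (h _).trans (mul_le_mul_of_nonneg_left (h' c) p)
  · simp only [LinearMap.comp_apply, e', e]

theorem boundary_mem_carriedMaps (n : ℕ) : S.boundary R n ∈ carriedMaps S S R (n + 1) n := by
  refine Submodule.sum_mem _ fun i _ => Submodule.smul_mem _ _ ?_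
  refine ⟨⟨1, zero_le_one, fun c => ?_⟩, fun g c => ?_, fun H c hc => ?_⟩
  · rw [one_mul]
    exact l1Norm_mapDomain_le _ _
  · simp only [Finsupp.lmapDomain_apply, ← Finsupp.mapDomain_comp]
    congr 1
    exact funext fun s => S.face_smul n i g s
  · refine mapDomain_mem_supported (fun s hs h hh => ?_) hc
    rw [← S.face_smul, hs h hh]

/-- Values for a carried map may be chosen simplexwise, subject to a `G`-invariant condition. -/
theorem exists_mem_carriedMaps {n m : ℕ} (P : S.obj n → (T.obj m →₀ R) → Prop)
    (hP : ∀ (g : G) s c, P s c → P (g • s) (c.mapDomain (g • ·))) (C : ℝ)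
    (hex : ∀ s, ∃ c, P s c ∧ l1Norm c ≤ C ∧
      c ∈ Finsupp.supported R R (T.fixedSimplices (MulAction.stabilizer G s) m)) :
    ∃ Φ ∈ carriedMaps S T R n m, ∀ s, P s (Φ (Finsupp.single s 1)) := by
  choose c hc hC hs using hex
  let rep : S.obj n → S.obj n := fun s => (Quotient.mk (MulAction.orbitRel G (S.obj n)) s).out
  have hrep : ∀ s, ∃ g : G, g • rep s = s := fun s =>
    (MulAction.orbitRel G (S.obj n)).symm (Quotient.mk_out (s := MulAction.orbitRel G (S.obj n)) s)
  have hrep' : ∀ (g : G) s, rep (g • s) = rep s := fun g s =>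
    congrArg Quotient.out (Quotient.sound (s := MulAction.orbitRel G (S.obj n)) ⟨g, rfl⟩)
  choose γ hγ using hrep
  -- The value chosen at the orbit representative is transported to `s` by an element `γ s`.
  let φ : S.obj n → (T.obj m →₀ R) := fun s => (c (rep s)).mapDomain (γ s • ·)
  have hφ : ∀ (g : G) s, φ (g • s) = (φ s).mapDomain (g • ·) := by
    intro g s
    -- Two transporting elements differ by an element of the stabilizer of the representative. It
    -- acts trivially on the chosen chain, so the transport is equivariant.
    have hst : (g * γ s)⁻¹ * γ (g • s) ∈ MulAction.stabilizer G (rep s) := by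
      have h1 := hγ (g • s)
      rw [hrep'] at h1
      rw [MulAction.mem_stabilizer_iff, mul_smul, h1, mul_inv_rev, mul_smul, inv_smul_smul,
        inv_smul_eq_iff, hγ]
    have h2 := mapDomain_smul_eq_self (hs (rep s)) hst
    simp only [φ, hrep']
    rw [← mapDomain_mul_smul]
    conv_rhs => rw [← h2, ← mapDomain_mul_smul, mul_inv_cancel_left]
  have hφ1 : ∀ s, P s (φ s) := by
    intro s
    have := hP (γ s) _ _ (hc (rep s))
    rwa [hγ] at this
  have hφ2 : ∀ s, l1Norm (φ s) ≤ C := fun s => (l1Norm_mapDomain_le _ _).trans (hC _)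
  have hφ3 : ∀ s, φ s ∈ Finsupp.supported R R
      (T.fixedSimplices (MulAction.stabilizer G s) m) := by
    intro s
    refine mapDomain_mem_supported (fun t ht => ?_) (hs (rep s))
    have := smul_mem_fixedSimplices (γ s) ht
    rwa [hγ] at this
  refine ⟨Finsupp.linearCombination R φ, ⟨⟨max C 0, le_max_right _ _, fun d => ?_⟩,
    fun g d => ?_, fun H d hd => ?_⟩, fun s => by simpa using hφ1 s⟩
  · rw [Finsupp.linearCombination_apply, Finsupp.sum]
    refine (l1Norm_sum_le _ _).trans ?_
    rw [l1Norm, Finsupp.sum, Finset.mul_sum]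
    refine Finset.sum_le_sum fun s _ => (l1Norm_smul_le _ _).trans ?_
    rw [mul_comm]
    exact mul_le_mul_of_nonneg_right ((hφ2 s).trans (le_max_left _ _)) (norm_nonneg _)
  · suffices h : Finsupp.linearCombination R φ ∘ₗ Finsupp.lmapDomain R R (g • ·) =
        Finsupp.lmapDomain R R (g • ·) ∘ₗ Finsupp.linearCombination R φ from
      LinearMap.congr_fun h d
    ext1 s
    ext1
    simp [Finsupp.mapDomain_single, hφ]
  · rw [Finsupp.linearCombination_apply]
    refine Submodule.sum_mem _ fun s hsd => Submodule.smul_mem _ _ ?_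
    -- A subgroup fixing `s` lies in the stabilizer of `s`, so it fixes the simplices of `φ s`.
    refine Finsupp.supported_mono (fixedSimplices_anti (fun h hh => ?_) m) (hφ3 s)
    exact hd hsd h hh

theorem single_mem_supported_stabilizer {n : ℕ} (s : S.obj n) :
    Finsupp.single s (1 : R) ∈
      Finsupp.supported R R (S.fixedSimplices (MulAction.stabilizer G s) n) :=
  Finsupp.single_mem_supported R 1 fun _ hh => hh

/-- A carried map with values in the cycles of a complex with cones lifts along the boundary. -/
theorem exists_boundary_comp_eq {n m : ℕ}
    (hT : ∀ s : S.obj n, Nonempty (T.FixedCone (MulAction.stabilizer G s)))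
    {Z : (S.obj n →₀ R) →ₗ[R] (T.obj m →₀ R)} (hZ : Z ∈ carriedMaps S T R n m)
    (hc : ∀ c, Z c ∈ T.cycles R m) :
    ∃ Φ ∈ carriedMaps S T R n (m + 1), T.boundary R m ∘ₗ Φ = Z := by
  obtain ⟨⟨C, hC0, hC⟩, he, hs⟩ := hZ
  obtain ⟨Φ, hΦ, h⟩ := exists_mem_carriedMaps (S := S) (T := T)
    (fun s c => T.boundary R m c = Z (Finsupp.single s 1))
    (fun g s c h => by
      -- The bound contains the norm of the basis element `single s 1`, and `‖(1 : R)‖` need not be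
      -- `1`.
      rw [boundary_smul, h, ← he, Finsupp.mapDomain_single]) (C * ‖(1 : R)‖)
    (fun s => by
      obtain ⟨K⟩ := hT s
      have hs' := hs _ _ (single_mem_supported_stabilizer s)
      refine ⟨(Z (Finsupp.single s 1)).mapDomain (K.cone m),
        K.boundary_cone_of_mem_cycles m _ hs' (hc _), ?_,
        mapDomain_mem_supported (K.cone_mem m) hs'⟩
      refine (l1Norm_mapDomain_le _ _).trans ((hC _).trans (le_of_eq ?_))
      simp [l1Norm])
  refine ⟨Φ, hΦ, ?_⟩
  ext1 s
  ext1
  exact h s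

/-- Each vertex may be sent to the apex of a cone for its stabilizer; this starts the recursion. -/
theorem exists_augmentation_comp_eq
    (hT : ∀ s : S.obj 0, Nonempty (T.FixedCone (MulAction.stabilizer G s))) :
    ∃ Φ ∈ carriedMaps S T R 0 0, T.augmentation R ∘ₗ Φ = S.augmentation R := by
  obtain ⟨Φ, hΦ, h⟩ := exists_mem_carriedMaps (S := S) (T := T)
    (fun _ c => T.augmentation R c = (1 : R))
    (fun g s c h => by rw [augmentation_smul, h]) ‖(1 : R)‖
    (fun s => by
      obtain ⟨K⟩ := hT s
      refine ⟨Finsupp.single K.base 1, by simp, by simp [l1Norm],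
        Finsupp.single_mem_supported R 1 K.base_mem⟩)
  refine ⟨Φ, hΦ, ?_⟩
  ext s
  simpa using h s

/-! ### Existence and uniqueness up to homotopy of carried chain maps. -/

/-- A chain map consisting of carried maps and compatible with the augmentations. -/
structure CarriedChainMap (S : SemisimplicialGSet.{u, w} G) (T : SemisimplicialGSet.{u, v} G)
    (R : Type x) [NormedCommRing R] where
  map : ∀ n, (S.obj n →₀ R) →ₗ[R] (T.obj n →₀ R)
  mem : ∀ n, map n ∈ carriedMaps S T R n n
  augmentation_map : T.augmentation R ∘ₗ map 0 = S.augmentation R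
  boundary_map : ∀ n, T.boundary R n ∘ₗ map (n + 1) = map n ∘ₗ S.boundary R n

/-- The identity chain map. -/
noncomputable def CarriedChainMap.id (S : SemisimplicialGSet.{u, w} G) (R : Type x)
    [NormedCommRing R] : CarriedChainMap S S R where
  map _ := LinearMap.id
  mem _ := id_mem_carriedMaps _
  augmentation_map := rfl
  boundary_map _ := rfl

/-- The composition of chain maps. -/
noncomputable def CarriedChainMap.comp {U : SemisimplicialGSet.{u, y} G}
    (ψ : CarriedChainMap T U R) (φ : CarriedChainMap S T R) : CarriedChainMap S U R where
  map n := ψ.map n ∘ₗ φ.map n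
  mem n := comp_mem_carriedMaps (ψ.mem n) (φ.mem n)
  augmentation_map := by
    rw [← LinearMap.comp_assoc, ψ.augmentation_map, φ.augmentation_map]
  boundary_map n := by
    rw [← LinearMap.comp_assoc, ψ.boundary_map, LinearMap.comp_assoc, φ.boundary_map,
      LinearMap.comp_assoc]

theorem exists_carriedChainMap
    (hT : ∀ n, ∀ s : S.obj n, Nonempty (T.FixedCone (MulAction.stabilizer G s))) :
    Nonempty (CarriedChainMap S T R) := by
  -- The recursion carries along that `Φ ∘ ∂` takes values in cycles, which is what the next lift
  -- requires.
  let A : ℕ → Type _ := fun n => {Φ : (S.obj n →₀ R) →ₗ[R] (T.obj n →₀ R) //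
    Φ ∈ carriedMaps S T R n n ∧ ∀ c, Φ (S.boundary R n c) ∈ T.cycles R n}
  have step : ∀ n (Φ : A n), ∃ Ψ : A (n + 1),
      T.boundary R n ∘ₗ Ψ.1 = Φ.1 ∘ₗ S.boundary R n := by
    rintro n ⟨Φ, hΦ, hc⟩
    obtain ⟨Ψ, hΨ, h⟩ := exists_boundary_comp_eq (hT (n + 1))
      (comp_mem_carriedMaps hΦ (boundary_mem_carriedMaps n)) hc
    refine ⟨⟨Ψ, hΨ, fun c => ?_⟩, h⟩
    change T.boundary R n (Ψ (S.boundary R (n + 1) c)) = 0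
    rw [← LinearMap.comp_apply, h, LinearMap.comp_apply, boundary_boundary, map_zero]
  obtain ⟨Φ₀, hΦ₀, h₀⟩ := exists_augmentation_comp_eq (R := R) (hT 0)
  choose next hnext using step
  let a : ∀ n, A n := fun n => Nat.rec ⟨Φ₀, hΦ₀, fun c => by
    change T.augmentation R (Φ₀ _) = 0
    rw [← LinearMap.comp_apply, h₀, augmentation_boundary]⟩ next n
  exact ⟨⟨fun n => (a n).1, fun n => (a n).2.1, h₀, fun n => hnext n (a n)⟩⟩

theorem sub_mem_carriedMaps {n m : ℕ} {Φ Ψ : (S.obj n →₀ R) →ₗ[R] (T.obj m →₀ R)}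
    (hΦ : Φ ∈ carriedMaps S T R n m) (hΨ : Ψ ∈ carriedMaps S T R n m) :
    Φ - Ψ ∈ carriedMaps S T R n m := by
  have h : Φ - Ψ = Φ + (-1 : R) • Ψ :=
    LinearMap.ext fun c => by simp [sub_eq_add_neg]
  rw [h]
  exact Submodule.add_mem _ hΦ (Submodule.smul_mem _ _ hΨ)

/-- A chain map to a complex with cones is null-homotopic if it is zero on augmentations. -/
theorem exists_nullhomotopy
    (hT : ∀ n, ∀ s : S.obj n, Nonempty (T.FixedCone (MulAction.stabilizer G s)))
    (D : ∀ n, (S.obj n →₀ R) →ₗ[R] (T.obj n →₀ R)) (hD : ∀ n, D n ∈ carriedMaps S T R n n)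
    (hD0 : ∀ c, T.augmentation R (D 0 c) = 0)
    (hbD : ∀ n c, T.boundary R n (D (n + 1) c) = D n (S.boundary R n c)) :
    ∃ h : ∀ n, (S.obj n →₀ R) →ₗ[R] (T.obj (n + 1) →₀ R),
      (∀ n, h n ∈ carriedMaps S T R n (n + 1)) ∧
      T.boundary R 0 ∘ₗ h 0 = D 0 ∧
      ∀ n, T.boundary R (n + 1) ∘ₗ h (n + 1) + h n ∘ₗ S.boundary R n = D (n + 1) := by
  -- The invariant `∂h∂ = D∂` says precisely that `D - h∂` takes values in cycles one degree higher,
  -- so that it can be lifted.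
  let A : ℕ → Type _ := fun n => {h : (S.obj n →₀ R) →ₗ[R] (T.obj (n + 1) →₀ R) //
    h ∈ carriedMaps S T R n (n + 1) ∧
      ∀ c, T.boundary R n (h (S.boundary R n c)) = D n (S.boundary R n c)}
  have step : ∀ n (h : A n), ∃ h' : A (n + 1),
      T.boundary R (n + 1) ∘ₗ h'.1 + h.1 ∘ₗ S.boundary R n = D (n + 1) := by
    rintro n ⟨h, hh, hc⟩
    obtain ⟨h', hh', e⟩ := exists_boundary_comp_eq (hT (n + 1))
      (sub_mem_carriedMaps (hD (n + 1)) (comp_mem_carriedMaps hh (boundary_mem_carriedMaps n)))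
      (fun c => by
        change T.boundary R n (D (n + 1) c - h (S.boundary R n c)) = 0
        rw [map_sub, hc, hbD, sub_self])
    refine ⟨⟨h', hh', fun c => ?_⟩, by
      rw [e]
      exact LinearMap.ext fun c => by simp⟩
    have := LinearMap.congr_fun e (S.boundary R (n + 1) c)
    simpa [boundary_boundary] using this
  obtain ⟨h₀, hh₀, e₀⟩ := exists_boundary_comp_eq (hT 0) (hD 0) hD0
  choose next hnext using step
  let a : ∀ n, A n := fun n => Nat.rec ⟨h₀, hh₀, fun c =>
    LinearMap.congr_fun e₀ (S.boundary R 0 c)⟩ next n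
  exact ⟨fun n => (a n).1, fun n => (a n).2.1, e₀, fun n => hnext n (a n)⟩

/-- Two augmentation-preserving chain maps to a complex with cones are chain homotopic. -/
theorem CarriedChainMap.exists_homotopy
    (hT : ∀ n, ∀ s : S.obj n, Nonempty (T.FixedCone (MulAction.stabilizer G s)))
    (φ ψ : CarriedChainMap S T R) :
    ∃ h : ∀ n, (S.obj n →₀ R) →ₗ[R] (T.obj (n + 1) →₀ R),
      (∀ n, h n ∈ carriedMaps S T R n (n + 1)) ∧
      T.boundary R 0 ∘ₗ h 0 = φ.map 0 - ψ.map 0 ∧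
      ∀ n, T.boundary R (n + 1) ∘ₗ h (n + 1) + h n ∘ₗ S.boundary R n =
        φ.map (n + 1) - ψ.map (n + 1) := by
  refine exists_nullhomotopy hT (fun n => φ.map n - ψ.map n)
    (fun n => sub_mem_carriedMaps (φ.mem n) (ψ.mem n)) (fun c => ?_) (fun n c => ?_)
  · have h1 := LinearMap.congr_fun φ.augmentation_map c
    have h2 := LinearMap.congr_fun ψ.augmentation_map c
    rw [LinearMap.comp_apply] at h1 h2
    rw [LinearMap.sub_apply, map_sub, h1, h2, sub_self]
  · have h1 := LinearMap.congr_fun (φ.boundary_map n) c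
    have h2 := LinearMap.congr_fun (ψ.boundary_map n) c
    rw [LinearMap.comp_apply, LinearMap.comp_apply] at h1 h2
    rw [LinearMap.sub_apply, map_sub, h1, h2, LinearMap.sub_apply]

/-! ### Induced maps on bounded cohomology. -/

section Cohomology

variable {V : Type y} [NormedAddCommGroup V] [Module R V] [IsBoundedSMul R V]
  [DistribMulAction G V] [SMulCommClass G R V]

/-- Precomposition of bounded equivariant cochains with a carried map. -/
noncomputable def cochainMap (V : Type y) [NormedAddCommGroup V] [Module R V] [IsBoundedSMul R V]
    [DistribMulAction G V] [SMulCommClass G R V] {n m : ℕ}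
    (Φ : (S.obj n →₀ R) →ₗ[R] (T.obj m →₀ R)) (hΦ : Φ ∈ carriedMaps S T R n m) :
    T.BoundedCochain R V m →ₗ[R] S.BoundedCochain R V n where
  toFun f := ⟨f.1 ∘ₗ Φ, by
    obtain ⟨⟨C, hC⟩, he⟩ := f.2
    obtain ⟨⟨C', hC0', hC'⟩, he', -⟩ := hΦ
    refine ⟨⟨|C| * C', fun c => ?_⟩, fun g c => ?_⟩
    · rw [mul_assoc]
      refine (hC _).trans ((mul_le_mul_of_nonneg_right (le_abs_self C) (l1Norm_nonneg _)).trans ?_)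
      exact mul_le_mul_of_nonneg_left (hC' c) (abs_nonneg C)
    · rw [LinearMap.comp_apply, he', he, LinearMap.comp_apply]⟩
  map_add' _ _ := rfl
  map_smul' _ _ := rfl

theorem cochainMap_coboundary (φ : CarriedChainMap S T R) (n : ℕ) (f : T.BoundedCochain R V n) :
    cochainMap V (φ.map (n + 1)) (φ.mem (n + 1)) (T.coboundary R V n f) =
      S.coboundary R V n (cochainMap V (φ.map n) (φ.mem n) f) := by
  apply Subtype.ext
  change (f.1 ∘ₗ T.boundary R n) ∘ₗ φ.map (n + 1) = (f.1 ∘ₗ φ.map n) ∘ₗ S.boundary R n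
  rw [LinearMap.comp_assoc, φ.boundary_map, LinearMap.comp_assoc]

/-- The map induced on cocycles. -/
noncomputable def CarriedChainMap.cocyclesMap (φ : CarriedChainMap S T R) (n : ℕ) :
    LinearMap.ker (T.coboundary R V n) →ₗ[R] LinearMap.ker (S.coboundary R V n) :=
  (cochainMap V (φ.map n) (φ.mem n)).restrict fun f hf => by
    rw [LinearMap.mem_ker] at hf ⊢
    rw [← cochainMap_coboundary, hf, map_zero]

theorem CarriedChainMap.coboundaries_le_comap (φ : CarriedChainMap S T R) (n : ℕ) :
    (T.coboundaries R V n).submoduleOf (LinearMap.ker (T.coboundary R V n)) ≤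
      ((S.coboundaries R V n).submoduleOf (LinearMap.ker (S.coboundary R V n))).comap
        (φ.cocyclesMap n) := by
  intro f hf
  change f.1 ∈ T.coboundaries R V n at hf
  change cochainMap V (φ.map n) (φ.mem n) f.1 ∈ S.coboundaries R V n
  cases n with
  | zero =>
    have : f.1 = 0 := hf
    rw [this, map_zero]
    exact Submodule.zero_mem _
  | succ n =>
    obtain ⟨b, hb⟩ := hf
    exact ⟨cochainMap V (φ.map n) (φ.mem n) b, by rw [← cochainMap_coboundary, hb]⟩

/-- The map induced on cohomology. -/
noncomputable def CarriedChainMap.cohomologyMap (φ : CarriedChainMap S T R) (V : Type y)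
    [NormedAddCommGroup V] [Module R V] [IsBoundedSMul R V] [DistribMulAction G V]
    [SMulCommClass G R V] (n : ℕ) : T.BoundedCohomology R V n →ₗ[R] S.BoundedCohomology R V n :=
  Submodule.mapQ _ _ (φ.cocyclesMap n) (φ.coboundaries_le_comap n)

/-- For a cocycle `f` one has `f∂ = 0`, so the homotopy formula leaves `f(φ - ψ) = (fh)∂`, a
coboundary of a bounded equivariant cochain. -/
theorem CarriedChainMap.cohomologyMap_congr
    (hT : ∀ n, ∀ s : S.obj n, Nonempty (T.FixedCone (MulAction.stabilizer G s)))
    (φ ψ : CarriedChainMap S T R) (n : ℕ) : φ.cohomologyMap V n = ψ.cohomologyMap V n := by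
  obtain ⟨h, hh, h0, hs⟩ := φ.exists_homotopy hT ψ
  refine Submodule.linearMap_qext _ (LinearMap.ext fun f => (Submodule.Quotient.eq _).2 ?_)
  change cochainMap V (φ.map n) (φ.mem n) f.1 - cochainMap V (ψ.map n) (ψ.mem n) f.1 ∈
    S.coboundaries R V n
  have hf : f.1.1 ∘ₗ T.boundary R n = 0 := congrArg Subtype.val f.2
  cases n with
  | zero =>
    -- In degree zero there are no nonzero coboundaries, so the two pullbacks must agree exactly.
    change _ = _
    apply Subtype.ext
    change f.1.1 ∘ₗ φ.map 0 - f.1.1 ∘ₗ ψ.map 0 = 0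
    rw [← LinearMap.comp_sub, ← h0, ← LinearMap.comp_assoc, hf, LinearMap.zero_comp]
  | succ n =>
    refine ⟨cochainMap V (h n) (hh n) f.1, ?_⟩
    apply Subtype.ext
    change (f.1.1 ∘ₗ h n) ∘ₗ S.boundary R n = f.1.1 ∘ₗ φ.map (n + 1) - f.1.1 ∘ₗ ψ.map (n + 1)
    rw [← LinearMap.comp_sub, ← hs, LinearMap.comp_add, ← LinearMap.comp_assoc, hf,
      LinearMap.zero_comp, zero_add, LinearMap.comp_assoc]

theorem CarriedChainMap.cohomologyMap_id (n : ℕ) :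
    (CarriedChainMap.id S R).cohomologyMap V n = LinearMap.id :=
  Submodule.linearMap_qext _ (LinearMap.ext fun _ => rfl)

theorem CarriedChainMap.cohomologyMap_comp {U : SemisimplicialGSet.{u, w} G}
    (ψ : CarriedChainMap T U R) (φ : CarriedChainMap S T R) (n : ℕ) :
    (ψ.comp φ).cohomologyMap V n = φ.cohomologyMap V n ∘ₗ ψ.cohomologyMap V n :=
  Submodule.linearMap_qext _ (LinearMap.ext fun _ => rfl)

/-- Semi-simplicial `G`-sets with stabilizers in a family and with cones on the fixed simplices of
its members all have the same bounded equivariant cohomology. -/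
theorem nonempty_boundedCohomology_equiv (F : SubgroupFamily G)
    (hS : ∀ n, ∀ s : S.obj n, MulAction.stabilizer G s ∈ F.carrier)
    (hT : ∀ n, ∀ t : T.obj n, MulAction.stabilizer G t ∈ F.carrier)
    (hS' : ∀ H ∈ F.carrier, Nonempty (S.FixedCone H))
    (hT' : ∀ H ∈ F.carrier, Nonempty (T.FixedCone H)) (n : ℕ) :
    Nonempty (S.BoundedCohomology R V n ≃ₗ[R] T.BoundedCohomology R V n) := by
  obtain ⟨φ⟩ := exists_carriedChainMap (R := R) fun n s => hT' _ (hS n s)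
  obtain ⟨ψ⟩ := exists_carriedChainMap (R := R) fun n t => hS' _ (hT n t)
  refine ⟨LinearEquiv.ofLinearMap (ψ.cohomologyMap V n) (φ.cohomologyMap V n) ?_ ?_⟩
  -- Each composite is a carried self-map over the augmentation, hence homotopic to the identity.
  · rw [← CarriedChainMap.cohomologyMap_comp, ← CarriedChainMap.cohomologyMap_id]
    exact CarriedChainMap.cohomologyMap_congr (fun n t => hT' _ (hT n t)) _ _ n
  · rw [← CarriedChainMap.cohomologyMap_comp, ← CarriedChainMap.cohomologyMap_id]
    exact CarriedChainMap.cohomologyMap_congr (fun n s => hS' _ (hS n s)) _ _ n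

end Cohomology

end SemisimplicialGSet

/-! ### Stabilizers and cones for coset tuples. -/

section CosetTuples

variable {G : Type u} [Group G] (F : SubgroupFamily G)

/-- The stabilizer of `gH` is `gHg⁻¹`. -/
theorem SubgroupFamily.stabilizer_quotient_mem {H : Subgroup G} (hH : H ∈ F.carrier) (a : G ⧸ H) :
    MulAction.stabilizer G a ∈ F.carrier := by
  induction a using QuotientGroup.induction_on with
  | H g =>
    have : MulAction.stabilizer G (g : G ⧸ H) = H.map (MulAut.conj g).toMonoidHom := by
      have h := MulAction.stabilizer_smul_eq_stabilizer_map_conj g ((1 : G) : G ⧸ H)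
      rw [MulAction.Quotient.smul_coe, smul_eq_mul, mul_one,
        MulAction.stabilizer_quotient] at h
      exact h
    rw [this]
    exact F.conj_mem H hH g

/-- An element fixing a tuple fixes its first entry, and the family is closed under subgroups. -/
theorem SubgroupFamily.stabilizer_cosetTuple_mem (n : ℕ) (s : F.cosetTuples.obj n) :
    MulAction.stabilizer G s ∈ F.carrier := by
  let s' : Fin (n + 1) → F.Cosets := s
  refine F.mem_of_le _ (F.stabilizer_quotient_mem (s' 0).1.2 (s' 0).2) _ fun g hg => ?_
  have h : g • s' 0 = s' 0 := congrFun (MulAction.mem_stabilizer_iff.1 hg) 0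
  rw [MulAction.mem_stabilizer_iff]
  have h2 := congr_arg_heq Sigma.snd h
  exact eq_of_heq h2

/-- Prepending the trivial coset of `H` to a tuple. -/
def SubgroupFamily.cosetTuplesFixedCone {H : Subgroup G} (hH : H ∈ F.carrier) :
    F.cosetTuples.FixedCone H :=
  let b : F.Cosets := ⟨⟨H, hH⟩, ((1 : G) : G ⧸ H)⟩
  have hb : ∀ h ∈ H, h • b = b := fun h hh => by
    have h1 : h • ((1 : G) : G ⧸ H) = ((1 : G) : G ⧸ H) := by
      rwa [← MulAction.mem_stabilizer_iff, MulAction.stabilizer_quotient]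
    exact congrArg (Sigma.mk (β := fun H : F.carrier => G ⧸ H.1) ⟨H, hH⟩) h1
  { base := fun _ => b
    cone := fun n s => Fin.cons (α := fun _ => F.Cosets) b s
    base_mem := fun h hh => funext fun _ => hb h hh
    cone_mem := fun n s hs h hh => funext fun i => by
      refine Fin.cases (hb h hh) (fun j => ?_) i
      exact congrFun (hs h hh) j
    face_zero_cone := fun n s _ => funext fun k => by
      change Fin.cons (α := fun _ => F.Cosets) b s (Fin.succAbove 0 k) = s k
      rw [Fin.zero_succAbove]
      rfl
    face_one_cone := fun s _ => funext fun k => by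
      refine Fin.cases rfl (fun j => j.elim0) k
    face_succ_cone := fun n s _ i => funext fun k => by
      change Fin.cons (α := fun _ => F.Cosets) b s (Fin.succAbove i.succ k) =
        Fin.cons (α := fun _ => F.Cosets) b (fun k => s (i.succAbove k)) k
      refine Fin.cases ?_ (fun j => ?_) k
      · rw [Fin.succ_succAbove_zero]
        rfl
      · rw [Fin.succ_succAbove_succ]
        rfl }

end CosetTuples

/-! ### The simplex `Δ^{n+1}` as a cone on `Δ^n`. -/

/-- The map `I × Δ^n → Δ^{n+1}` sending `(t, p)` to `(t, (1 - t) p)`. -/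
noncomputable def simplexConeMap (n : ℕ) :
    C(unitInterval × stdSimplex ℝ (Fin (n + 1)), stdSimplex ℝ (Fin (n + 2))) where
  toFun q := ⟨Fin.cons (α := fun _ => ℝ) (q.1 : ℝ) fun i => (1 - (q.1 : ℝ)) * q.2 i, by
    constructor
    · intro i
      refine Fin.cases q.1.2.1 (fun j => ?_) i
      exact mul_nonneg (sub_nonneg.2 q.1.2.2) (q.2.2.1 j)
    · rw [Fin.sum_univ_succ]
      simp only [Fin.cons_zero, Fin.cons_succ]
      rw [← Finset.mul_sum, stdSimplex.sum_eq_one]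
      ring⟩
  continuous_toFun := by
    refine Continuous.subtype_mk (continuous_pi fun i => ?_) _
    refine Fin.cases ?_ (fun j => ?_) i
    · simp only [Fin.cons_zero]
      fun_prop
    · simp only [Fin.cons_succ]
      have : Continuous fun q : unitInterval × stdSimplex ℝ (Fin (n + 1)) => q.2 j :=
        (continuous_apply j).comp (continuous_subtype_val.comp continuous_snd)
      fun_prop

theorem simplexConeMap_zero {n : ℕ} (q : unitInterval × stdSimplex ℝ (Fin (n + 1))) :
    simplexConeMap n q 0 = (q.1 : ℝ) := rfl

theorem simplexConeMap_succ {n : ℕ} (q : unitInterval × stdSimplex ℝ (Fin (n + 1))) (i : Fin (n + 1)) :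
    simplexConeMap n q i.succ = (1 - (q.1 : ℝ)) * q.2 i := rfl

theorem surjective_simplexConeMap (n : ℕ) : Function.Surjective (simplexConeMap n) := by
  intro p
  have hsum : p 0 + ∑ i : Fin (n + 1), p i.succ = 1 := by
    rw [← Fin.sum_univ_succ, stdSimplex.sum_eq_one]
  have h0 : 0 ≤ p 0 := stdSimplex.zero_le p 0
  have h1 : p 0 ≤ 1 := stdSimplex.le_one p 0
  -- At the apex any point of `Δ^n` is a preimage; elsewhere the other coordinates are rescaled by
  -- `1 - p 0`.
  by_cases hp : p 0 = 1
  · refine ⟨(1, stdSimplex.vertex 0), stdSimplex.ext (funext fun i => ?_)⟩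
    refine Fin.cases ?_ (fun j => ?_) i
    · rw [simplexConeMap_zero, hp]
      rfl
    · have hz : ∑ i : Fin (n + 1), p i.succ = 0 := by linarith
      have := (Finset.sum_eq_zero_iff_of_nonneg
        (fun i _ => stdSimplex.zero_le p (Fin.succ i))).1 hz j (Finset.mem_univ _)
      rw [simplexConeMap_succ, this]
      simp
  · have hne : 1 - p 0 ≠ 0 := fun h => hp (by linarith)
    have hpos : 0 ≤ 1 - p 0 := by linarith
    refine ⟨(⟨p 0, h0, h1⟩, ⟨fun i => p i.succ / (1 - p 0), fun i =>
      div_nonneg (stdSimplex.zero_le p _) hpos, ?_⟩), stdSimplex.ext (funext fun i => ?_)⟩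
    · rw [← Finset.sum_div, div_eq_one_iff_eq hne]
      linarith
    · refine Fin.cases rfl (fun j => ?_) i
      rw [simplexConeMap_succ]
      exact mul_div_cancel₀ _ hne

/-- A continuous surjection from a compact space to a Hausdorff space is a quotient map. Continuous
maps on `Δ^{n+1}` can therefore be defined on `I × Δ^n`. -/
theorem isQuotientMap_simplexConeMap (n : ℕ) :
    Topology.IsQuotientMap (simplexConeMap n) :=
  Topology.IsQuotientMap.of_surjective_continuous (surjective_simplexConeMap n)
    (simplexConeMap n).continuous

theorem stdSimplex_map_apply_of_injective {m n : ℕ} {φ : Fin m → Fin n}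
    (hφ : Function.Injective φ) (p : stdSimplex ℝ (Fin m)) (i : Fin m) :
    stdSimplex.map φ p (φ i) = p i := by
  rw [stdSimplex.map_coe, FunOnFinite.linearMap_apply_apply]
  rw [Finset.sum_eq_single i]
  · intro j hj hne
    exact absurd (hφ (by simpa using hj)) hne
  · intro h
    simp at h

theorem stdSimplex_map_apply_of_notMem_range {m n : ℕ} {φ : Fin m → Fin n}
    (p : stdSimplex ℝ (Fin m)) (i : Fin n) (h : ∀ j, φ j ≠ i) :
    stdSimplex.map φ p i = 0 := by
  rw [stdSimplex.map_coe, FunOnFinite.linearMap_apply_apply]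
  refine Finset.sum_eq_zero fun j hj => absurd (by simpa using hj) (h j)

theorem simplexFaceInclusion_succAbove {n : ℕ} (i : Fin (n + 2)) (p : stdSimplex ℝ (Fin (n + 1)))
    (k : Fin (n + 1)) : simplexFaceInclusion n i p (i.succAbove k) = p k :=
  stdSimplex_map_apply_of_injective Fin.succAbove_right_injective p k

theorem simplexFaceInclusion_self {n : ℕ} (i : Fin (n + 2)) (p : stdSimplex ℝ (Fin (n + 1))) :
    simplexFaceInclusion n i p i = 0 :=
  stdSimplex_map_apply_of_notMem_range p i fun j => Fin.succAbove_ne i j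

theorem simplexFaceInclusion_zero {n : ℕ} (p : stdSimplex ℝ (Fin (n + 1))) :
    simplexFaceInclusion n 0 p = simplexConeMap n (0, p) := by
  refine stdSimplex.ext (funext fun i => Fin.cases ?_ (fun j => ?_) i)
  · rw [simplexFaceInclusion_self]
    rfl
  · rw [simplexConeMap_succ]
    have := simplexFaceInclusion_succAbove 0 p j
    simpa using this

theorem simplexFaceInclusion_one (p : stdSimplex ℝ (Fin 1)) :
    simplexFaceInclusion 0 1 p = simplexConeMap 0 (1, p) := by
  refine stdSimplex.ext (funext fun i => Fin.cases ?_ (fun j => ?_) i)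
  · have := simplexFaceInclusion_succAbove 1 p 0
    rw [simplexConeMap_zero]
    have hp : p 0 = 1 := by simp
    rw [hp] at this
    exact this
  · rw [Subsingleton.elim j 0, simplexConeMap_succ]
    have := simplexFaceInclusion_self 1 p
    simpa using this

/-- This and the two preceding identities locate the faces of the cone: the base, the apex, and the
cones on the faces of the base. They become the axioms of `FixedCone`. -/
theorem simplexFaceInclusion_succ_cone {n : ℕ} (i : Fin (n + 2)) (t : unitInterval)
    (p : stdSimplex ℝ (Fin (n + 1))) :
    simplexFaceInclusion (n + 1) i.succ (simplexConeMap n (t, p)) =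
      simplexConeMap (n + 1) (t, simplexFaceInclusion n i p) := by
  refine stdSimplex.ext (funext fun k => Fin.cases ?_ (fun j => ?_) k)
  · have := simplexFaceInclusion_succAbove i.succ (simplexConeMap n (t, p)) 0
    rw [Fin.succ_succAbove_zero] at this
    exact this
  · rw [simplexConeMap_succ]
    rcases Fin.eq_self_or_eq_succAbove i j with rfl | ⟨l, rfl⟩
    · rw [simplexFaceInclusion_self, simplexFaceInclusion_self, mul_zero]
    · have := simplexFaceInclusion_succAbove i.succ (simplexConeMap n (t, p)) l.succ
      rw [Fin.succ_succAbove_succ] at this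
      rw [this, simplexFaceInclusion_succAbove]
      rfl

/-! ### Cones on singular simplices along a contraction. -/

section SingularCone

variable {Z : Type v} [TopologicalSpace Z] {z₀ : Z}

/-- The cone map identifies points only at `t = 1`, where the contraction is constant. -/
theorem factorsThrough_simplexConeMap
    (K : (ContinuousMap.id Z).Homotopy (ContinuousMap.const Z z₀)) {n : ℕ}
    (τ : C(stdSimplex ℝ (Fin (n + 1)), Z)) :
    Function.FactorsThrough
      (K.toContinuousMap.comp ((ContinuousMap.id unitInterval).prodMap τ))
      (simplexConeMap n) := by
  rintro ⟨t, p⟩ ⟨t', p'⟩ h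
  have ht : t = t' := Subtype.ext (by
    have := congrArg (fun q : stdSimplex ℝ (Fin (n + 2)) => q 0) h
    simpa only [simplexConeMap_zero] using this)
  subst ht
  change K (t, τ p) = K (t, τ p')
  by_cases h1 : t = 1
  · rw [h1, K.apply_one, K.apply_one]
    rfl
  · have hne : 1 - (t : ℝ) ≠ 0 := fun h => h1 (Subtype.ext (by
      rw [Set.Icc.coe_one]
      linarith))
    have hp : p = p' := stdSimplex.ext (funext fun i => by
      have := congrArg (fun q : stdSimplex ℝ (Fin (n + 2)) => q i.succ) h
      simp only [simplexConeMap_succ] at this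
      exact mul_left_cancel₀ hne this)
    rw [hp]

/-- The cone on a singular simplex with respect to a contraction of the space. -/
noncomputable def singularCone (K : (ContinuousMap.id Z).Homotopy (ContinuousMap.const Z z₀))
    {n : ℕ} (τ : C(stdSimplex ℝ (Fin (n + 1)), Z)) : C(stdSimplex ℝ (Fin (n + 2)), Z) :=
  (isQuotientMap_simplexConeMap n).lift
    (K.toContinuousMap.comp ((ContinuousMap.id unitInterval).prodMap τ))
    (factorsThrough_simplexConeMap K τ)

variable (K : (ContinuousMap.id Z).Homotopy (ContinuousMap.const Z z₀))

theorem singularCone_simplexConeMap {n : ℕ} (τ : C(stdSimplex ℝ (Fin (n + 1)), Z)) (t : unitInterval)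
    (p : stdSimplex ℝ (Fin (n + 1))) :
    singularCone K τ (simplexConeMap n (t, p)) = K (t, τ p) :=
  DFunLike.congr_fun ((isQuotientMap_simplexConeMap n).lift_comp _
    (factorsThrough_simplexConeMap K τ)) (t, p)

theorem singularCone_face_zero {n : ℕ} (τ : C(stdSimplex ℝ (Fin (n + 1)), Z)) :
    (singularCone K τ).comp (simplexFaceInclusion n 0) = τ := by
  ext p
  rw [ContinuousMap.comp_apply, simplexFaceInclusion_zero, singularCone_simplexConeMap,
    K.apply_zero]
  rfl

theorem singularCone_face_one (τ : C(stdSimplex ℝ (Fin 1), Z)) :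
    (singularCone K τ).comp (simplexFaceInclusion 0 1) = ContinuousMap.const _ z₀ := by
  ext p
  rw [ContinuousMap.comp_apply, simplexFaceInclusion_one, singularCone_simplexConeMap,
    K.apply_one]
  rfl

theorem singularCone_face_succ {n : ℕ} (τ : C(stdSimplex ℝ (Fin (n + 2)), Z)) (i : Fin (n + 2)) :
    (singularCone K τ).comp (simplexFaceInclusion (n + 1) i.succ) =
      singularCone K (τ.comp (simplexFaceInclusion n i)) := by
  ext q
  obtain ⟨⟨t, p⟩, rfl⟩ := surjective_simplexConeMap n q
  rw [ContinuousMap.comp_apply, simplexFaceInclusion_succ_cone, singularCone_simplexConeMap,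
    singularCone_simplexConeMap]
  rfl

end SingularCone

/-! ### Fixed singular simplices as singular simplices of the fixed space. -/

section FixedSimplices

variable {G : Type u} [Group G] {X : Type v} [TopologicalSpace X] [MulAction G X]
  {H : Subgroup G}

/-- The inclusion of the space of fixed points. -/
def fixedInclusion (H : Subgroup G) (X : Type v) [TopologicalSpace X] [MulAction G X] :
    C(MulAction.fixedPoints H X, X) :=
  ⟨Subtype.val, continuous_subtype_val⟩

theorem fixedInclusion_comp_injective {A : Type w} [TopologicalSpace A] :
    Function.Injective fun τ : C(A, MulAction.fixedPoints H X) => (fixedInclusion H X).comp τ :=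
  fun _ _ h => ContinuousMap.ext fun p => Subtype.ext (DFunLike.congr_fun h p)

/-- Coning off singular simplices of the space of fixed points along a contraction, extended
arbitrarily to the other singular simplices. -/
noncomputable def extendedSingularCone {z₀ : MulAction.fixedPoints H X}
    (K : (ContinuousMap.id (MulAction.fixedPoints H X)).Homotopy
      (ContinuousMap.const _ z₀)) (n : ℕ) :
    C(stdSimplex ℝ (Fin (n + 1)), X) → C(stdSimplex ℝ (Fin (n + 2)), X) :=
  Function.extend (fun τ => (fixedInclusion H X).comp τ)
    (fun τ => (fixedInclusion H X).comp (singularCone K τ))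
    (fun _ => (fixedInclusion H X).comp (ContinuousMap.const _ z₀))

theorem extendedSingularCone_comp {z₀ : MulAction.fixedPoints H X}
    (K : (ContinuousMap.id (MulAction.fixedPoints H X)).Homotopy
      (ContinuousMap.const _ z₀)) {n : ℕ}
    (τ : C(stdSimplex ℝ (Fin (n + 1)), MulAction.fixedPoints H X)) :
    extendedSingularCone K n ((fixedInclusion H X).comp τ) =
      (fixedInclusion H X).comp (singularCone K τ) :=
  fixedInclusion_comp_injective.extend_apply _ _ τ

variable [ContinuousConstSMul G X]

theorem mem_fixedSimplices_singularSimplices {n : ℕ} {τ : C(stdSimplex ℝ (Fin (n + 1)), X)} :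
    τ ∈ (singularSimplices G X).fixedSimplices H n ↔ ∀ p, τ p ∈ MulAction.fixedPoints H X :=
  ⟨fun hτ p h => DFunLike.congr_fun (F := C(stdSimplex ℝ (Fin (n + 1)), X)) (hτ h.1 h.2) p,
    fun hτ h hh => ContinuousMap.ext fun p => hτ p ⟨h, hh⟩⟩

theorem comp_fixedInclusion_mem {n : ℕ}
    (τ : C(stdSimplex ℝ (Fin (n + 1)), MulAction.fixedPoints H X)) :
    (fixedInclusion H X).comp τ ∈ (singularSimplices G X).fixedSimplices H n :=
  mem_fixedSimplices_singularSimplices.2 fun p => (τ p).2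

theorem exists_eq_comp_fixedInclusion {n : ℕ} {τ : C(stdSimplex ℝ (Fin (n + 1)), X)}
    (hτ : τ ∈ (singularSimplices G X).fixedSimplices H n) :
    ∃ τ' : C(stdSimplex ℝ (Fin (n + 1)), MulAction.fixedPoints H X),
      τ = (fixedInclusion H X).comp τ' :=
  ⟨⟨fun p => ⟨τ p, mem_fixedSimplices_singularSimplices.1 hτ p⟩,
    τ.continuous.subtype_mk _⟩, rfl⟩

/-- A contraction of the space of `H`-fixed points provides cones on the `H`-fixed singular
simplices. -/
noncomputable def singularFixedCone {z₀ : MulAction.fixedPoints H X}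
    (K : (ContinuousMap.id (MulAction.fixedPoints H X)).Homotopy
      (ContinuousMap.const _ z₀)) :
    (singularSimplices G X).FixedCone H where
  base := (fixedInclusion H X).comp (ContinuousMap.const _ z₀)
  cone := extendedSingularCone K
  base_mem := comp_fixedInclusion_mem _
  cone_mem n τ hτ := by
    obtain ⟨τ', rfl⟩ := exists_eq_comp_fixedInclusion hτ
    rw [extendedSingularCone_comp]
    exact comp_fixedInclusion_mem _
  face_zero_cone n τ hτ := by
    obtain ⟨τ', rfl⟩ := exists_eq_comp_fixedInclusion hτ
    rw [extendedSingularCone_comp]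
    change ((fixedInclusion H X).comp (singularCone K _)).comp (simplexFaceInclusion n 0) = _
    rw [ContinuousMap.comp_assoc, singularCone_face_zero]
  face_one_cone τ hτ := by
    obtain ⟨τ', rfl⟩ := exists_eq_comp_fixedInclusion hτ
    rw [extendedSingularCone_comp]
    change ((fixedInclusion H X).comp (singularCone K _)).comp (simplexFaceInclusion 0 1) = _
    rw [ContinuousMap.comp_assoc, singularCone_face_one]
  face_succ_cone n τ hτ i := by
    obtain ⟨τ', rfl⟩ := exists_eq_comp_fixedInclusion hτ
    rw [extendedSingularCone_comp]
    change ((fixedInclusion H X).comp (singularCone K _)).comp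
      (simplexFaceInclusion (n + 1) i.succ) = extendedSingularCone K n
        ((fixedInclusion H X).comp (τ'.comp (simplexFaceInclusion n i)))
    rw [extendedSingularCone_comp, ContinuousMap.comp_assoc, singularCone_face_succ]

/-- An element fixing a singular simplex fixes the image of its first vertex. -/
theorem stabilizer_singularSimplex_mem (F : SubgroupFamily G)
    (hX : ∀ p : X, MulAction.stabilizer G p ∈ F.carrier) (n : ℕ)
    (τ : (singularSimplices G X).obj n) : MulAction.stabilizer G τ ∈ F.carrier := by
  let τ' : C(stdSimplex ℝ (Fin (n + 1)), X) := τ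
  refine F.mem_of_le _ (hX (τ' (stdSimplex.vertex 0))) _ fun g hg => ?_
  exact DFunLike.congr_fun (MulAction.mem_stabilizer_iff.1 hg : g • τ' = τ') _

end FixedSimplices

/-! ### Contractibility of the fixed spaces of a classifying space. -/

section FixedPointSpace

theorem mem_fixedPoints_subgroup {G : Type u} [Group G] {X : Type v} [MulAction G X]
    {H : Subgroup G} {p : X} :
    p ∈ MulAction.fixedPoints H X ↔ ∀ h ∈ H, h • p = p :=
  ⟨fun hp h hh => hp ⟨h, hh⟩, fun hp h => hp h.1 h.2⟩

variable {G : Type u} [Group G] {X : Type v} [TopologicalSpace X] [MulAction G X]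
  {H : Subgroup G}

namespace GCWStructure

variable (S : GCWStructure G X)

theorem eq_of_charMap_eq {n : ℕ} {q q' : Σ i : S.cell n, G ⧸ S.isotropy n i}
    {p p' : Metric.closedBall (0 : EuclideanSpace ℝ (Fin n)) 1}
    (hp : ‖(p : EuclideanSpace ℝ (Fin n))‖ < 1) (hp' : ‖(p' : EuclideanSpace ℝ (Fin n))‖ < 1)
    (h : S.charMap n q.1 q.2 p = S.charMap n q'.1 q'.2 p') : q = q' ∧ p = p' := by
  have h1 := (S.charMap_interior n).injOn
  have h2 := @h1 (q, p) (Set.mem_ofPred.2 hp) (q', p') (Set.mem_ofPred.2 hp') h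
  exact Prod.mk.inj h2

/-- Characteristic maps are jointly injective on open cells, so fixing an interior point forces
fixing the coset that indexes its cell. -/
theorem smul_eq_of_charMap_mem_fixedPoints {n : ℕ} {i : S.cell n} {a : G ⧸ S.isotropy n i}
    {p : Metric.closedBall (0 : EuclideanSpace ℝ (Fin n)) 1}
    (hp : ‖(p : EuclideanSpace ℝ (Fin n))‖ < 1)
    (hfix : S.charMap n i a p ∈ MulAction.fixedPoints H X) {h : G} (hh : h ∈ H) : h • a = a := by
  have h1 : S.charMap n i (h • a) p = S.charMap n i a p := by
    rw [S.charMap_smul]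
    exact mem_fixedPoints_subgroup.1 hfix h hh
  have h2 := (S.eq_of_charMap_eq (q := ⟨i, h • a⟩) (q' := ⟨i, a⟩) hp hp h1).1
  exact eq_of_heq (Sigma.mk.inj h2).2

theorem charMap_mem_fixedPoints {n : ℕ} {i : S.cell n} {a : G ⧸ S.isotropy n i}
    (ha : ∀ h ∈ H, h • a = a) (p : Metric.closedBall (0 : EuclideanSpace ℝ (Fin n)) 1) :
    S.charMap n i a p ∈ MulAction.fixedPoints H X :=
  mem_fixedPoints_subgroup.2 fun h hh => by rw [← S.charMap_smul, ha h hh]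

/-- The weak topology on the fixed points is determined by the fixed cells. -/
theorem isClosed_of_charMap_of_subset_fixedPoints {n : ℕ} {B : Set X} (hB : B ⊆ S.skel (n + 1))
    (hBH : B ⊆ MulAction.fixedPoints H X) (hBn : IsClosed (B ∩ S.skel n))
    (hcell : ∀ (i : S.cell n) (a : G ⧸ S.isotropy n i), (∀ h ∈ H, h • a = a) →
      IsClosed (S.charMap n i a ⁻¹' B)) : IsClosed B := by
  refine S.isClosed_of_charMap n B hB hBn fun i a => ?_
  by_cases ha : ∀ h ∈ H, h • a = a
  · exact hcell i a ha
  -- A cell not fixed by `H` meets `X^H` only along its boundary sphere, where the lower skeleton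
  -- controls closedness.
  · have : S.charMap n i a ⁻¹' B = {p : Metric.closedBall (0 : EuclideanSpace ℝ (Fin n)) 1 |
        ‖(p : EuclideanSpace ℝ (Fin n))‖ = 1} ∩
        S.charMap n i a ⁻¹' (B ∩ S.skel n) := by
      ext p
      constructor
      · intro hp
        have h1 : ‖(p : EuclideanSpace ℝ (Fin n))‖ = 1 := by
          refine le_antisymm (mem_closedBall_zero_iff.1 p.2) (not_lt.1 fun hlt => ha ?_)
          exact fun h hh => S.smul_eq_of_charMap_mem_fixedPoints hlt (hBH hp) hh
        exact ⟨h1, hp, S.charMap_boundary n i a p h1⟩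
      · exact fun hp => hp.2.1
    rw [this]
    exact (isClosed_eq (continuous_norm.comp continuous_subtype_val) continuous_const).inter
      (hBn.preimage (S.continuous_charMap n i a))

theorem isClosed_fixedPoints_inter_skel (H : Subgroup G) (n : ℕ) :
    IsClosed (MulAction.fixedPoints H X ∩ S.skel n) := by
  induction n with
  | zero => simp [S.skel_zero]
  | succ n ih =>
    refine S.isClosed_of_charMap_of_subset_fixedPoints Set.inter_subset_right
      Set.inter_subset_left ?_ fun i a ha => ?_
    · rwa [Set.inter_assoc, Set.inter_eq_right.2 (S.skel_subset_succ n)]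
    · have hpre : S.charMap n i a ⁻¹' (MulAction.fixedPoints H X ∩ S.skel (n + 1)) = Set.univ := by
        refine Set.eq_univ_of_forall fun p => ⟨S.charMap_mem_fixedPoints ha p, ?_⟩
        rcases (mem_closedBall_zero_iff.1 p.2).lt_or_eq with hp | hp
        · exact ((S.charMap_interior n).mapsTo (x := (⟨i, a⟩, p)) hp).1
        · exact S.skel_subset_succ n (S.charMap_boundary n i a p hp)
      rw [hpre]
      exact isClosed_univ

/-- Closedness of `X^H` allows closed subsets of `X^H` to be tested in `X`, so the subspace topology
on `X^H` is the weak topology of its cells. -/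
theorem isClosed_fixedPoints (S : GCWStructure G X) (H : Subgroup G) : IsClosed (MulAction.fixedPoints H X) :=
  S.isClosed_of_skel _ fun n => S.isClosed_fixedPoints_inter_skel H n

end GCWStructure

/-- The `G`-space `G/H × X^H`. -/
def InducedFixedPoints (H : Subgroup G) (X : Type v) [MulAction G X] : Type (max u v) :=
  Σ _ : G ⧸ H, MulAction.fixedPoints H X

namespace InducedFixedPoints

instance : TopologicalSpace (InducedFixedPoints H X) :=
  inferInstanceAs (TopologicalSpace (Σ _ : G ⧸ H, MulAction.fixedPoints H X))

/-- The action moves only the coset, since `X^H` need not be `G`-invariant; the action on `X` enters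
through `desc`. -/
instance {X : Type v} [MulAction G X] : MulAction G (InducedFixedPoints H X) where
  smul g y := ⟨g • y.1, y.2⟩
  one_smul y := Sigma.ext (one_smul G y.1) HEq.rfl
  mul_smul g h y := Sigma.ext (mul_smul g h y.1) HEq.rfl

/-- The inclusion of the copy of `X^H` indexed by a coset. -/
def incl {X : Type v} [MulAction G X] (a : G ⧸ H) (z : MulAction.fixedPoints H X) : InducedFixedPoints H X := ⟨a, z⟩

theorem smul_incl {X : Type v} [MulAction G X] (g : G) (a : G ⧸ H) (z : MulAction.fixedPoints H X) :
    g • incl a z = incl (g • a) z := rfl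

theorem continuous_incl (a : G ⧸ H) : Continuous (incl (X := X) a) :=
  continuous_sigmaMk (σ := fun _ : G ⧸ H => MulAction.fixedPoints H X)

theorem continuous_iff {A : Type w} [TopologicalSpace A] {f : InducedFixedPoints H X → A} :
    Continuous f ↔ ∀ a, Continuous fun z => f (incl a z) :=
  continuous_sigma_iff (σ := fun _ : G ⧸ H => MulAction.fixedPoints H X)

theorem isClosed_iff {B : Set (InducedFixedPoints H X)} :
    IsClosed B ↔ ∀ a, IsClosed (incl a ⁻¹' B) :=
  isClosed_sigma_iff (σ := fun _ : G ⧸ H => MulAction.fixedPoints H X)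

instance : ContinuousConstSMul G (InducedFixedPoints H X) :=
  ⟨fun g => continuous_iff.2 fun a => continuous_incl (g • a)⟩

/-- The `G`-CW-structure on `G/H × X^H` whose cells are the `H`-fixed cells of `X`. -/
def gcwStructure (S : GCWStructure G X) (H : Subgroup G) :
    GCWStructure G (InducedFixedPoints H X) where
  skel n := {y | y.2.1 ∈ S.skel n}
  skel_zero := by
    simp [S.skel_zero]
  skel_subset_succ n y hy := S.skel_subset_succ n hy
  smul_mem_skel _ _ _ hy := hy
  iUnion_skel := Set.eq_univ_of_forall fun y => by
    have : y.2.1 ∈ ⋃ n, S.skel n := by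
      rw [S.iUnion_skel]
      trivial
    obtain ⟨n, hn⟩ := Set.mem_iUnion.1 this
    exact Set.mem_iUnion.2 ⟨n, hn⟩
  isClosed_of_skel A hA := by
    refine isClosed_iff.2 fun a => ?_
    have hemb := (S.isClosed_fixedPoints H).isClosedEmbedding_subtypeVal
    rw [hemb.isClosed_iff_image_isClosed]
    refine S.isClosed_of_skel _ fun n => ?_
    have := hemb.isClosed_iff_image_isClosed.1 (isClosed_iff.1 (hA n) a)
    convert this using 1
    ext p
    constructor
    · rintro ⟨⟨z, hz, rfl⟩, hn⟩
      exact ⟨z, ⟨hz, hn⟩, rfl⟩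
    · rintro ⟨z, ⟨hz, hn⟩, rfl⟩
      exact ⟨⟨z, hz, rfl⟩, hn⟩
  cell n := {q : Σ i : S.cell n, G ⧸ S.isotropy n i // ∀ h ∈ H, h • q.2 = q.2}
  -- Each single cell `a × D^n` of `X` with `a` fixed by `H` is an ordinary cell of `X^H`, and its
  -- product with `G/H` is one equivariant cell of type `H`.
  isotropy _ _ := H
  charMap n q a p := incl a ⟨S.charMap n q.1.1 q.1.2 p, S.charMap_mem_fixedPoints q.2 p⟩
  continuous_charMap n q a :=
    (continuous_incl a).comp ((S.continuous_charMap n q.1.1 q.1.2).subtype_mk _)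
  charMap_smul _ _ _ _ _ := rfl
  charMap_boundary n q _ p hp := S.charMap_boundary n q.1.1 q.1.2 p hp
  charMap_interior n := by
    refine ⟨fun q hq => (S.charMap_interior n).mapsTo (x := (q.1.1.1, q.2)) hq, ?_, ?_⟩
    · rintro ⟨⟨⟨q, hq⟩, a⟩, p⟩ hp ⟨⟨⟨q', hq'⟩, a'⟩, p'⟩ hp' h
      have h1 : a = a' := congrArg (fun y : InducedFixedPoints H X => y.1) h
      have h2 : S.charMap n q.1 q.2 p = S.charMap n q'.1 q'.2 p' :=
        congrArg (fun y : InducedFixedPoints H X => y.2.1) h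
      obtain ⟨rfl, rfl⟩ := S.eq_of_charMap_eq hp hp' h2
      subst h1
      rfl
    · rintro ⟨a, z⟩ hz
      obtain ⟨⟨q, p⟩, hp, hqp⟩ := (S.charMap_interior n).surjOn hz
      have hfix : S.charMap n q.1 q.2 p ∈ MulAction.fixedPoints H X := by
        have hqp' : S.charMap n q.1 q.2 p = z.1 := hqp
        rw [hqp']
        exact z.2
      refine ⟨(⟨⟨q, fun h hh => S.smul_eq_of_charMap_mem_fixedPoints hp hfix hh⟩, a⟩, p), hp, ?_⟩
      exact congrArg (incl a) (Subtype.ext hqp)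
  isClosed_of_charMap n B hB hBn hcell := by
    refine isClosed_iff.2 fun a => ?_
    have hemb := (S.isClosed_fixedPoints H).isClosedEmbedding_subtypeVal
    rw [hemb.isClosed_iff_image_isClosed]
    refine S.isClosed_of_charMap_of_subset_fixedPoints (n := n) (H := H) ?_ ?_ ?_ ?_
    · rintro _ ⟨z, hz, rfl⟩
      exact hB hz
    · rintro _ ⟨z, hz, rfl⟩
      exact z.2
    · have := hemb.isClosed_iff_image_isClosed.1 (isClosed_iff.1 hBn a)
      convert this using 1
      ext p
      constructor
      · rintro ⟨⟨z, hz, rfl⟩, hn⟩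
        exact ⟨z, ⟨hz, hn⟩, rfl⟩
      · rintro ⟨z, ⟨hz, hn⟩, rfl⟩
        exact ⟨⟨z, hz, rfl⟩, hn⟩
    · intro i b hb
      convert hcell ⟨⟨i, b⟩, hb⟩ a using 1
      ext p
      constructor
      · rintro ⟨z, hz, hzp⟩
        have : z = ⟨S.charMap n i b p, S.charMap_mem_fixedPoints hb p⟩ := Subtype.ext hzp
        rw [this] at hz
        exact hz
      · exact fun hp => ⟨_, hp, rfl⟩

theorem isGCWComplex (F : SubgroupFamily G) (hH : H ∈ F.carrier) (S : GCWStructure G X) :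
    IsGCWComplexWithStabilizersIn F (InducedFixedPoints H X) where
  nonempty_structure := ⟨gcwStructure S H⟩
  stabilizer_mem y := F.mem_of_le _ (F.stabilizer_quotient_mem hH y.1) _ fun _ hg =>
    congrArg (fun y : InducedFixedPoints H X => y.1) (MulAction.mem_stabilizer_iff.1 hg)

theorem smul_incl_one {X : Type v} [MulAction G X] {h : G} (hh : h ∈ H) (z : MulAction.fixedPoints H X) :
    h • incl ((1 : G) : G ⧸ H) z = incl ((1 : G) : G ⧸ H) z := by
  have h1 : h • ((1 : G) : G ⧸ H) = ((1 : G) : G ⧸ H) := by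
    rwa [← MulAction.mem_stabilizer_iff, MulAction.stabilizer_quotient]
  rw [smul_incl, h1]

/-- Representatives of one coset differ by an element of `H`, which fixes `z`. Hence the choice of
representatives in `desc` does not matter. -/
theorem smul_eq_smul_of_coe_eq {X : Type v} [MulAction G X] {g g' : G} (h : (g : G ⧸ H) = g') (z : MulAction.fixedPoints H X) :
    g • z.1 = g' • z.1 := by
  have := mem_fixedPoints_subgroup.1 z.2 _ (QuotientGroup.eq.1 h)
  rw [mul_smul, inv_smul_eq_iff] at this
  exact this.symm

variable [ContinuousConstSMul G X]

/-- The `G`-map `G/H × X^H → X` induced by a self-map of `X^H`. -/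
noncomputable def desc (f : C(MulAction.fixedPoints H X, MulAction.fixedPoints H X)) :
    C(InducedFixedPoints H X, X) where
  toFun y := y.1.out • (f y.2).1
  continuous_toFun := continuous_iff.2 fun a =>
    (continuous_subtype_val.comp f.continuous).const_smul a.out

theorem isGMap_desc (f : C(MulAction.fixedPoints H X, MulAction.fixedPoints H X)) :
    IsGMap (G := G) (desc f) := by
  intro g y
  change (g • y.1).out • (f y.2).1 = g • y.1.out • (f y.2).1
  rw [← mul_smul]
  refine smul_eq_smul_of_coe_eq ?_ _
  rw [QuotientGroup.out_eq', ← smul_eq_mul, ← MulAction.Quotient.smul_coe, QuotientGroup.out_eq']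

theorem desc_incl_one (f : C(MulAction.fixedPoints H X, MulAction.fixedPoints H X))
    (z : MulAction.fixedPoints H X) : desc f (incl ((1 : G) : G ⧸ H) z) = (f z).1 := by
  change ((1 : G) : G ⧸ H).out • (f z).1 = (f z).1
  conv_rhs => rw [← one_smul G (f z).1]
  exact smul_eq_smul_of_coe_eq (QuotientGroup.out_eq' _) _

end InducedFixedPoints

/-- The trivial coset is fixed by `H`, so its copy of `X^H` consists of `H`-fixed points, and
`G`-maps preserve these. -/
theorem IsGMap.apply_incl_one_mem {Y : Type w} [TopologicalSpace Y] [MulAction G Y]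
    {f : C(InducedFixedPoints H X, Y)} (hf : IsGMap (G := G) f) (z : MulAction.fixedPoints H X) :
    f (InducedFixedPoints.incl ((1 : G) : G ⧸ H) z) ∈ MulAction.fixedPoints H Y :=
  mem_fixedPoints_subgroup.2 fun h hh => by
    rw [← hf, InducedFixedPoints.smul_incl_one hh]

/-- The one-point `G`-CW-complex. -/
def GCWStructure.punit (G : Type u) [Group G] : GCWStructure G PUnit.{v + 1} where
  -- By the index shift `skel 0` is empty and the single `0`-cell appears in `skel 1`.
  skel n := {_p | n ≠ 0}
  skel_zero := by simp
  skel_subset_succ n _ _ := n.succ_ne_zero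
  smul_mem_skel _ _ _ hp := hp
  iUnion_skel := Set.eq_univ_of_forall fun _ => Set.mem_iUnion.2 ⟨1, one_ne_zero⟩
  isClosed_of_skel _ _ := isClosed_discrete _
  cell n := {_p : PUnit.{v + 1} // n = 0}
  isotropy _ _ := ⊤
  charMap _ _ _ _ := PUnit.unit
  continuous_charMap _ _ _ := continuous_const
  charMap_smul _ _ _ _ _ := rfl
  charMap_boundary n i _ p hp := by
    obtain ⟨-, rfl⟩ := i
    rw [Subsingleton.elim (p : EuclideanSpace ℝ (Fin 0)) 0, norm_zero] at hp
    exact absurd hp zero_ne_one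
  charMap_interior n := by
    refine ⟨?_, ?_, ?_⟩
    · rintro ⟨⟨⟨-, rfl⟩, -⟩, -⟩ -
      simp
    · rintro ⟨⟨⟨_, rfl⟩, a⟩, p⟩ - ⟨⟨⟨_, h⟩, a'⟩, p'⟩ - -
      obtain rfl : p = p' := Subtype.ext (Subsingleton.elim _ _)
      obtain rfl : a = a' := QuotientGroup.subsingleton_quotient_top.elim _ _
      rfl
    · rintro p ⟨-, hn⟩
      have hn' : n = 0 := by simpa using hn
      refine ⟨(⟨⟨PUnit.unit, hn'⟩, ((1 : G) : G ⧸ (⊤ : Subgroup G))⟩, ⟨0, by simp⟩), ?_, rfl⟩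
      simp
  isClosed_of_charMap _ _ _ _ _ := isClosed_discrete _

variable [ContinuousConstSMul G X]

/-- The `G`-space induced from a point is `G/H`, and a `G`-map from `G/H` to `X` picks out a point
of `X^H`. -/
theorem IsClassifyingSpace.nonempty_fixedPoints {F : SubgroupFamily G}
    (hX : IsClassifyingSpace F X) (hH : H ∈ F.carrier) :
    Nonempty (MulAction.fixedPoints H X) := by
  obtain ⟨f, hf⟩ := hX.exists_gMap (InducedFixedPoints H PUnit.{v + 1})
    (InducedFixedPoints.isGCWComplex F hH (GCWStructure.punit G))
  exact ⟨⟨_, hf.apply_incl_one_mem ⟨PUnit.unit, fun _ => rfl⟩⟩⟩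

/-- The fixed points in a classifying space of a member of the family are contractible. -/
theorem IsClassifyingSpace.exists_contraction {F : SubgroupFamily G}
    (hX : IsClassifyingSpace F X) (hH : H ∈ F.carrier) :
    ∃ z₀ : MulAction.fixedPoints H X,
      Nonempty ((ContinuousMap.id (MulAction.fixedPoints H X)).Homotopy
        (ContinuousMap.const _ z₀)) := by
  obtain ⟨z₀⟩ := hX.nonempty_fixedPoints hH
  obtain ⟨S⟩ := hX.isGCWComplex.nonempty_structure
  -- The two maps are `(gH, z) ↦ gz` and `(gH, z) ↦ gz₀`. Every stage of the homotopy is a `G`-map,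
  -- so on the trivial coset it stays inside `X^H`.
  obtain ⟨L⟩ := hX.gHomotopic (InducedFixedPoints H X) (InducedFixedPoints.isGCWComplex F hH S)
    (InducedFixedPoints.desc (ContinuousMap.id _))
    (InducedFixedPoints.desc (ContinuousMap.const _ z₀))
    (InducedFixedPoints.isGMap_desc _) (InducedFixedPoints.isGMap_desc _)
  refine ⟨z₀, ⟨{
    toFun := fun q => ⟨L (q.1, InducedFixedPoints.incl ((1 : G) : G ⧸ H) q.2),
      IsGMap.apply_incl_one_mem (L.prop' q.1) q.2⟩
    continuous_toFun := Continuous.subtype_mk (L.continuous.comp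
      (continuous_fst.prodMk ((InducedFixedPoints.continuous_incl _).comp continuous_snd))) _
    map_zero_left := fun z => Subtype.ext ?_
    map_one_left := fun z => Subtype.ext ?_ }⟩⟩
  · exact (L.apply_zero _).trans (InducedFixedPoints.desc_incl_one _ z)
  · exact (L.apply_one _).trans (InducedFixedPoints.desc_incl_one _ z)

end FixedPointSpace

theorem mainTheorem5 {G : Type u} [Group G] (F : SubgroupFamily G)
    {R : Type x} [NormedCommRing R]
    {V : Type y} [NormedAddCommGroup V] [Module R V] [IsBoundedSMul R V]
    [DistribMulAction G V] [SMulCommClass G R V] (hV : ∀ (g : G) (m : V), ‖g • m‖ = ‖m‖)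
    {X : Type v} [TopologicalSpace X] [MulAction G X] [ContinuousConstSMul G X]
    (hX : IsClassifyingSpace F X) (n : ℕ) :
    Nonempty (BoundedBredonCohomology F R V n ≃ₗ[R] EquivariantBoundedCohomology G X R V n) := by
  refine SemisimplicialGSet.nonempty_boundedCohomology_equiv F F.stabilizer_cosetTuple_mem
    (stabilizer_singularSimplex_mem F hX.isGCWComplex.stabilizer_mem)
    (fun H hH => ⟨F.cosetTuplesFixedCone hH⟩) (fun H hH => ?_) n
  obtain ⟨z₀, ⟨K⟩⟩ := hX.exists_contraction hH
  exact ⟨singularFixedCone K⟩
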